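/- Let $\pi:\mathbb R\to(0,\infty)$ be a (measurable) probability density with respect to Lebesgue measure that is bounded away from $0$ and $\infty$ on compact sets, and write $\pi(\cdot)$ for the corresponding distribution. Let $G^{-1}:\mathbb R\to(0,\infty)$ be measurable and bounded away from $0$ and $\infty$ on compact sets. For $h>0$ let $Q_h(x,\cdot)=\mathcal N(x,hG^{-1}(x))$ with density $q_h(y\mid x)$. The position-dependent random walk Metropolis (PDRWM) chain with step size $h$ is the Markov chain with transition kernel $$P_h(x,dy)=\alpha_h(x,y)\,Q_h(x,dy)+r_h(x)\,\delta_x(dy),\qquad \alpha_h(x,y)=1\wedge\frac{\pi(y)\,q_h(x\mid y)}{\pi(x)\,q_h(y\mid x)},\qquad r_h(x)=1-\int\alpha_h(x,y)\,Q_h(x,dy).$$ Suppose that $G^{-1}(x)=\Theta(|x|^2)$, in the sense that $G^{-1}(x)/|x|^2\to C$ as $|x|\to\infty$ for some $C>0$, and that $\pi$ decays at least polynomially in the tails: for some $p>1$ and $x_0>0$, $$\frac{\pi(y)}{\pi(x)}\le\frac{|y|^{-p}}{|x|^{-p}}\quad\text{for all } y\ge x\ge x_0 \text{ and for all } y\le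 x\le -x_0 .$$ Then there is an $h_0>0$ such that for every $h\in(0,h_0)$ the PDRWM chain is geometrically ergodic from $\pi$-almost every starting point: there are a function $M:\mathbb R\to(0,\infty)$ and a constant $\rho\in(0,1)$ such that, for $\pi$-almost every $x$ and every $n\ge 0$, $$\sup_{A}\,|P_h^n(x,A)-\pi(A)|\le M(x)\rho^n ,$$ the supremum being over the Borel sets $A\subseteq\mathbb R$. -/

import Mathlib

open MeasureTheory ProbabilityTheory Filter Topology
open scoped NNReal ENNReal

namespace PDRWM

/-! ### Total variation and geometric ergodicity -/

/-- Total variation distance `sup_A |μ(A) - ν(A)|` over measurable sets `A`. -/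
noncomputable def tvDist {X : Type*} [MeasurableSpace X] (μ ν : Measure X) : ℝ :=
  ⨆ A : {A : Set X // MeasurableSet A}, |μ.real A - ν.real A|

/-- The chain with transition kernel `P` is geometrically ergodic with limit `μ`, from `μ`-almost
every starting point: `‖Pⁿ(x, ·) - μ‖_TV ≤ M(x) ρⁿ`, where `ρ < 1` does not depend on `x`, and
`P ^ n` is the `n`-step transition kernel. -/
def GeometricallyErgodic {X : Type*} [MeasurableSpace X] (P : Kernel X X) (μ : Measure X) : Prop :=
  ∃ (M : X → ℝ) (ρ : ℝ), (∀ x, 0 < M x) ∧ 0 < ρ ∧ ρ < 1 ∧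
    ∀ᵐ x ∂μ, ∀ n : ℕ, tvDist ((P ^ n) x) μ ≤ M x * ρ ^ n

/-! ### The position-dependent random walk Metropolis kernel on the line -/

/-- Proposal variance `h G⁻¹(x)`. -/
noncomputable def propVar (Ginv : ℝ → ℝ) (h : ℝ) (x : ℝ) : ℝ≥0 := (h * Ginv x).toNNReal

/-- Proposal density `q(y | x)`: the density at `y` of `N(x, h G⁻¹(x))`. -/
noncomputable def propDensity (Ginv : ℝ → ℝ) (h x y : ℝ) : ℝ :=
  gaussianPDFReal x (propVar Ginv h x) y

/-- Metropolis-Hastings acceptance rate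
`α(x, y) = 1 ∧ (π(y) q(x | y)) / (π(x) q(y | x))`. -/
noncomputable def accept (π Ginv : ℝ → ℝ) (h x y : ℝ) : ℝ :=
  min 1 (π y * propDensity Ginv h y x / (π x * propDensity Ginv h x y))

lemma measurable_propVar {Ginv : ℝ → ℝ} (hG : Measurable Ginv) (h : ℝ) :
    Measurable (propVar Ginv h) :=
  (hG.const_mul h).real_toNNReal

lemma measurable_propDensity {Ginv : ℝ → ℝ} (hG : Measurable Ginv) (h : ℝ) :
    Measurable (fun z : ℝ × ℝ => propDensity Ginv h z.1 z.2) :=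
  measurable_uncurry_gaussianPDFReal.comp
    (measurable_fst.prodMk (((measurable_propVar hG h).comp measurable_fst).prodMk measurable_snd))

lemma measurable_accept {π Ginv : ℝ → ℝ} (hπ : Measurable π) (hG : Measurable Ginv) (h : ℝ) :
    Measurable (fun z : ℝ × ℝ => accept π Ginv h z.1 z.2) := by
  have h1 := measurable_propDensity hG h
  have h2 : Measurable (fun z : ℝ × ℝ => propDensity Ginv h z.2 z.1) := h1.comp measurable_swap
  exact measurable_const.min
    (((hπ.comp measurable_snd).mul h2).div ((hπ.comp measurable_fst).mul h1))

/-- The proposal kernel `Q(x, ·) = N(x, h G⁻¹(x))`. -/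
noncomputable def proposal (Ginv : ℝ → ℝ) (hG : Measurable Ginv) (h : ℝ) : Kernel ℝ ℝ where
  toFun x := gaussianReal x (propVar Ginv h x)
  measurable' := measurable_gaussianReal.comp (measurable_id.prodMk (measurable_propVar hG h))

instance (Ginv : ℝ → ℝ) (hG : Measurable Ginv) (h : ℝ) : IsMarkovKernel (proposal Ginv hG h) :=
  ⟨fun x => instIsProbabilityMeasureGaussianReal x (propVar Ginv h x)⟩

/-- Rejection probability `r(x) = 1 - ∫ α(x, y) Q(x, dy)`. -/
noncomputable def reject (π Ginv : ℝ → ℝ) (h x : ℝ) : ℝ≥0∞ :=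
  1 - ∫⁻ y, ENNReal.ofReal (accept π Ginv h x y) ∂(gaussianReal x (propVar Ginv h x))

lemma measurable_accept_ofReal {π Ginv : ℝ → ℝ} (hπ : Measurable π) (hG : Measurable Ginv)
    (h : ℝ) :
    Measurable (Function.uncurry fun x y : ℝ => ENNReal.ofReal (accept π Ginv h x y)) :=
  ENNReal.measurable_ofReal.comp (measurable_accept hπ hG h)

lemma measurable_reject {π Ginv : ℝ → ℝ} (hπ : Measurable π) (hG : Measurable Ginv) (h : ℝ) :
    Measurable (reject π Ginv h) :=
  measurable_const.sub
    ((measurable_accept_ofReal hπ hG h).lintegral_kernel_prod_right (κ := proposal Ginv hG h))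

/-- The transition kernel of the position-dependent random walk Metropolis chain,
`P(x, dy) = α(x, y) Q(x, dy) + r(x) δ_x(dy)`. -/
noncomputable def kernel (π Ginv : ℝ → ℝ) (hπ : Measurable π) (hG : Measurable Ginv) (h : ℝ) :
    Kernel ℝ ℝ where
  toFun x :=
    (gaussianReal x (propVar Ginv h x)).withDensity (fun y => ENNReal.ofReal (accept π Ginv h x y))
      + reject π Ginv h x • Measure.dirac x
  measurable' := by
    refine Measure.measurable_of_measurable_coe _ fun s hs => ?_
    simp only [Measure.coe_add, Measure.coe_smul, Pi.add_apply, Pi.smul_apply, smul_eq_mul,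
      withDensity_apply _ hs, Measure.dirac_apply' _ hs]
    exact ((measurable_accept_ofReal hπ hG h).setLIntegral_kernel_prod_right
      (κ := proposal Ginv hG h) hs).add
      ((measurable_reject hπ hG h).mul (measurable_one.indicator hs))

instance (π Ginv : ℝ → ℝ) (hπ : Measurable π) (hG : Measurable Ginv) (h : ℝ) :
    IsMarkovKernel (kernel π Ginv hπ hG h) := by
  refine ⟨fun x => ⟨?_⟩⟩
  have hle : ∫⁻ y, ENNReal.ofReal (accept π Ginv h x y)
      ∂(gaussianReal x (propVar Ginv h x)) ≤ 1 := by
    calc _ ≤ ∫⁻ _, 1 ∂(gaussianReal x (propVar Ginv h x)) :=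
          lintegral_mono fun y => ENNReal.ofReal_le_one.2 (min_le_left _ _)
      _ = 1 := by simp
  change ((gaussianReal x (propVar Ginv h x)).withDensity
    (fun y => ENNReal.ofReal (accept π Ginv h x y)) + reject π Ginv h x • Measure.dirac x) _ = 1
  simp only [Measure.coe_add, Measure.coe_smul, Pi.add_apply, Pi.smul_apply, smul_eq_mul,
    withDensity_apply _ MeasurableSet.univ, Measure.restrict_univ, measure_univ, mul_one]
  exact add_tsub_cancel_of_le hle

/-! ### Conditions on the target density and on the proposal variance -/

/-- The probability distribution with Lebesgue density `π`. -/
noncomputable def target (π : ℝ → ℝ) : Measure ℝ :=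
  volume.withDensity (fun x => ENNReal.ofReal (π x))

/-- `f` is bounded away from `0` and `∞` on compact sets. -/
def LocBoundedAway (f : ℝ → ℝ) : Prop :=
  ∀ K : Set ℝ, IsCompact K → ∃ a b : ℝ, 0 < a ∧ ∀ x ∈ K, a ≤ f x ∧ f x ≤ b

/-- `f` decays in both tails at least as fast as `|x|^{-p}`: moving outwards from `±x` to `±y`
changes `f` by a factor of at most `|y|^{-p} / |x|^{-p}`. -/
def PolyTails (f : ℝ → ℝ) (p : ℝ) : Prop :=
  ∃ x₀ : ℝ, 0 < x₀ ∧ ∀ x y : ℝ, x₀ ≤ x → x ≤ y →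
    f y / f x ≤ y ^ (-p) / x ^ (-p) ∧ f (-y) / f (-x) ≤ y ^ (-p) / x ^ (-p)

/-- `f(x) = Θ(|x|²)` in the sense that `f(x) / |x|² → C` for some `C > 0` as `|x| → ∞`. -/
def QuadraticGrowth (f : ℝ → ℝ) : Prop :=
  ∃ C : ℝ, 0 < C ∧ Tendsto (fun x => f x / |x| ^ 2) (Bornology.cobounded ℝ) (𝓝 C)

end PDRWM

/-! The proof applies Harris' theorem (`geometricallyErgodic_of_drift_of_minorization`) to the
Lyapunov function `|x|^s`, with `s = (q - 1) / 2` and `q = min p 2`. Detailed balance gives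
invariance (`kernel_invariant`), and positivity of the densities on compact sets gives minorization
(`exists_minorization`). The substance is the drift condition in the tails.

Write a move from `x` as `y = u * x`. Since the proposal variance grows like `C x²`, the law of `u`
under the proposal tends to `N(1, v)` with `v = h * C`, so the relative drift of `|x|^s` has a limit
problem free of `x`. The true target may be replaced there by `|x|^{-q}`: faster decay only makes
outward moves rarer and inward moves likelier, and both lower the drift (`drift_le_driftBound`).
Dominated convergence then passes to the limit (`tendsto_integral_driftBound`).

In the limit, detailed balance under `u ↦ u⁻¹` symmetrizes the drift on `u > 0`. The exponent `s` is
the one for which it becomes exactly `-½ ∫ (u^s - 1)²` against the accepted density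
(`integral_profile_symm`), hence negative. Moves across the origin can raise `|x|^s` only if `u <
-1`. Their contribution is smaller by a factor `exp (-1 / v)` than the gain, so the total is
negative once `v` is small (`exists_integral_limitDrift_neg`); this is why `h` must be small. -/

namespace PDRWM

/-! ### Harris' theorem via contraction of a weighted oscillation seminorm -/

/-- A function whose oscillation is controlled by a sum of weights is, up to an additive constant,
controlled by the weight. -/
lemma exists_const_abs_sub_le {X : Type*} [Nonempty X] {φ w : X → ℝ}
    (h : ∀ x y, |φ x - φ y| ≤ w x + w y) : ∃ c, ∀ x, |φ x - c| ≤ w x := by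
  have hub : ∀ x y, φ x - w x ≤ φ y + w y := fun x y => by
    have := (abs_le.1 (h x y)).2; linarith
  obtain ⟨x₀⟩ := ‹Nonempty X›
  have hb : BddAbove (Set.range fun x => φ x - w x) :=
    ⟨φ x₀ + w x₀, by rintro _ ⟨x, rfl⟩; exact hub x x₀⟩
  have : Nonempty X := ⟨x₀⟩
  refine ⟨⨆ x, (φ x - w x), fun x => abs_le.2 ⟨?_, ?_⟩⟩
  · have := ciSup_le fun y => hub y x; linarith
  · have := le_ciSup hb x; linarith

section Harris

variable {X : Type*} [MeasurableSpace X]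

instance isMarkovKernel_pow (P : Kernel X X) [IsMarkovKernel P] (n : ℕ) :
    IsMarkovKernel (P ^ n) := by
  induction n with
  | zero =>
    rw [pow_zero]
    change IsMarkovKernel (Kernel.id : Kernel X X)
    infer_instance
  | succ n ih =>
    rw [pow_succ]
    change IsMarkovKernel ((P ^ n) ∘ₖ P)
    infer_instance

lemma real_pow_succ_apply (P : Kernel X X) [IsMarkovKernel P] (n : ℕ) (x : X) {A : Set X}
    (hA : MeasurableSet A) :
    ((P ^ (n + 1)) x).real A = ∫ y, ((P ^ n) y).real A ∂(P x) := by
  rw [measureReal_def, pow_succ]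
  change (((P ^ n) ∘ₖ P) x A).toReal = _
  rw [Kernel.comp_apply' _ _ _ hA]
  simp only [measureReal_def]
  rw [integral_toReal]
  · exact ((P ^ n).measurable_coe hA).aemeasurable
  · exact ae_of_all _ fun y => measure_lt_top _ _

/-- One step of a Markov kernel contracts the weighted oscillation seminorm, up to the drift. -/
lemma abs_integral_sub_le_of_le {P : Kernel X X} [IsMarkovKernel P] {w φ : X → ℝ} {L : ℝ}
    (hL : 0 ≤ L) (hw : ∀ x, 1 ≤ w x) (hwint : ∀ x, Integrable w (P x))
    (hφint : ∀ x, Integrable φ (P x))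
    (hφ : ∀ x y, |φ x - φ y| ≤ L * (w x + w y)) (m : Measure X) [IsFiniteMeasure m] {x y : X}
    (hx : m ≤ P x) (hy : m ≤ P y) :
    |∫ z, φ z ∂(P x) - ∫ z, φ z ∂(P y)| ≤
      L * (∫ z, w z ∂(P x) + ∫ z, w z ∂(P y) - 2 * m.real Set.univ) := by
  have : Nonempty X := ⟨x⟩
  obtain ⟨c, hc⟩ := exists_const_abs_sub_le (φ := φ) (w := fun x => L * w x)
    (fun x y => by linarith [hφ x y])
  have key : ∀ x y, m ≤ P x → m ≤ P y → ∫ z, φ z ∂(P x) - ∫ z, φ z ∂(P y) ≤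
      L * (∫ z, w z ∂(P x) + ∫ z, w z ∂(P y) - 2 * m.real Set.univ) := by
    intro x y hx hy
    have hi : ∀ x, Integrable (fun z => φ z - c) (P x) := fun x =>
      (hφint x).sub (integrable_const c)
    have hwi : ∀ x, Integrable (fun z => L * w z) (P x) := fun x => (hwint x).const_mul L
    -- The functions `L * w ∓ (φ - c)` are nonnegative, so their integrals only drop when `P x`, `P
    -- y` are replaced by the common part `m`. On adding the two bounds, `φ` cancels over `m` and
    -- the mass of `m` is saved twice.
    have h1 := integral_mono_measure (f := fun z => L * w z - (φ z - c)) hx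
      (ae_of_all _ fun z => by have := (abs_le.1 (hc z)).2; simp only [Pi.zero_apply]; linarith)
      ((hwi x).sub (hi x))
    have h2 := integral_mono_measure (f := fun z => L * w z + (φ z - c)) hy
      (ae_of_all _ fun z => by have := (abs_le.1 (hc z)).1; simp only [Pi.zero_apply]; linarith)
      ((hwi y).add (hi y))
    have hwm : Integrable (fun z => L * w z) m := (hwi x).mono_measure hx
    have him : Integrable (fun z => φ z - c) m := (hi x).mono_measure hx
    rw [integral_sub hwm him, integral_sub (hwi x) (hi x)] at h1
    rw [integral_add hwm him, integral_add (hwi y) (hi y)] at h2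
    have h3 : L * m.real Set.univ ≤ ∫ z, L * w z ∂m := by
      calc L * m.real Set.univ = ∫ _, L ∂m := by simp [mul_comm]
        _ ≤ ∫ z, L * w z ∂m := integral_mono (integrable_const L) hwm
            fun z => le_mul_of_one_le_right hL (hw z)
    have h4 : ∀ x, ∫ z, (φ z - c) ∂(P x) = ∫ z, φ z ∂(P x) - c := fun x => by
      rw [integral_sub (hφint x) (integrable_const c)]; simp
    rw [h4, integral_const_mul] at h1 h2
    rw [integral_const_mul] at h1 h2 h3
    linarith
  rw [abs_le]
  exact ⟨by linarith [key y x hy hx], key x y hx hy⟩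

/-- **Harris' theorem**: a Foster-Lyapunov drift condition together with a minorization on the
sublevel sets of the Lyapunov function implies geometric ergodicity. -/
theorem geometricallyErgodic_of_drift_of_minorization (P : Kernel X X) [IsMarkovKernel P]
    (μ : Measure X) [IsProbabilityMeasure μ] (hinv : P.Invariant μ) {V : X → ℝ}
    (hV0 : ∀ x, 0 ≤ V x) (hVint : ∀ x, Integrable V (P x)) {γ K : ℝ}
    (hγ0 : 0 ≤ γ) (hγ1 : γ < 1) (hK : 0 ≤ K) (hdrift : ∀ x, ∫ y, V y ∂(P x) ≤ γ * V x + K)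
    (hminor : ∀ R : ℝ, ∃ m : Measure X, m Set.univ ≠ 0 ∧ ∀ x, V x ≤ R → m ≤ P x)
    (hμV : Integrable V μ) : GeometricallyErgodic P μ := by
  set δ := 1 - γ with hδ
  have hδ0 : 0 < δ := by linarith
  -- Above this level, half of the drift gain `δ * (V x + V y)` is at least `2 * (K + 1)`, which
  -- absorbs the two constants `K` with room to spare.
  set R := 4 * (K + 1) / δ with hR
  have hR0 : 0 < R := by positivity
  obtain ⟨m', hm'0, hm'⟩ := hminor R
  obtain ⟨a, ha0, ha1, m, hmfin, hma, hm⟩ : ∃ a : ℝ, 0 < a ∧ a ≤ 1 ∧ ∃ m : Measure X,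
      IsFiniteMeasure m ∧ (∀ x, V x ≤ R → a ≤ m.real Set.univ) ∧ ∀ x, V x ≤ R → m ≤ P x := by
    -- An empty sublevel set gives no bound on the mass of `m'`; there `m = 0` works vacuously.
    by_cases hx : ∃ x, V x ≤ R
    · obtain ⟨x, hx⟩ := hx
      have hle : m' Set.univ ≤ 1 := (hm' x hx Set.univ).trans_eq measure_univ
      have hfin : IsFiniteMeasure m' := ⟨hle.trans_lt ENNReal.one_lt_top⟩
      refine ⟨m'.real Set.univ, ENNReal.toReal_pos hm'0 (measure_ne_top _ _), ?_, m', hfin,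
        fun _ _ => le_rfl, hm'⟩
      exact ENNReal.toReal_le_of_le_ofReal zero_le_one (by simpa using hle)
    · push Not at hx
      exact ⟨1, one_pos, le_rfl, 0, inferInstance, fun x h => absurd h (not_le.2 (hx x)),
        fun x h => absurd h (not_le.2 (hx x))⟩
  -- The weight `1 + β * V` must be flat enough that the drift constants cost at most `a` of the `2
  -- * a` saved by the minorization.
  set β := a / (2 * (K + 1)) with hβ
  have hβ0 : 0 < β := by positivity
  have hβK : 2 * β * K ≤ a := by
    rw [hβ]
    have : 2 * (a / (2 * (K + 1))) * K = a * (K / (K + 1)) := by field_simp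
    rw [this]
    exact mul_le_of_le_one_right ha0.le (by rw [div_le_one (by positivity)]; linarith)
  -- The bound `a / 2` serves pairs with `V x + V y ≤ R`; the bounds `β` and `δ / 2` serve the
  -- others.
  set η := min (min β (δ / 2)) (a / 2) with hη
  have hη0 : 0 < η := by positivity
  have hηβ : η ≤ β := (min_le_left _ _).trans (min_le_left _ _)
  have hηδ : η ≤ δ / 2 := (min_le_left _ _).trans (min_le_right _ _)
  have hηa : η ≤ a / 2 := min_le_right _ _
  set ρ := 1 - η with hρ
  have hρ0 : 0 < ρ := by linarith
  have hρ1 : ρ < 1 := by linarith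
  set w : X → ℝ := fun x => 1 + β * V x with hw
  have hw1 : ∀ x, 1 ≤ w x := fun x => by
    have := mul_nonneg hβ0.le (hV0 x); simp only [hw]; linarith
  have hwint : ∀ x, Integrable w (P x) := fun x =>
    (integrable_const 1).add ((hVint x).const_mul β)
  have hwP : ∀ x, ∫ z, w z ∂(P x) ≤ 1 + β * (γ * V x + K) := fun x => by
    simp only [hw]
    rw [integral_add (integrable_const 1) ((hVint x).const_mul β), integral_const_mul]
    simp only [integral_const, probReal_univ, smul_eq_mul, one_mul]
    exact add_le_add_right (mul_le_mul_of_nonneg_left (hdrift x) hβ0.le) 1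
  have hstep : ∀ φ : X → ℝ, (∀ x, Integrable φ (P x)) → ∀ L : ℝ, 0 ≤ L →
      (∀ x y, |φ x - φ y| ≤ L * (w x + w y)) → ∀ x y,
      |∫ z, φ z ∂(P x) - ∫ z, φ z ∂(P y)| ≤ ρ * L * (w x + w y) := by
    intro φ hφi L hL hφ x y
    rw [mul_comm ρ L, mul_assoc]
    have hsum : w x + w y = 2 + β * (V x + V y) := by simp only [hw]; ring
    by_cases hxy : V x + V y ≤ R
    · have hxR : V x ≤ R := by linarith [hV0 y]
      have hyR : V y ≤ R := by linarith [hV0 x]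
      refine (abs_integral_sub_le_of_le hL hw1 hwint hφi hφ m (hm x hxR) (hm y hyR)).trans ?_
      refine mul_le_mul_of_nonneg_left ?_ hL
      have h1 := hma x hxR
      have h2 := mul_nonneg hβ0.le (add_nonneg (hV0 x) (hV0 y))
      rw [hsum]
      have h3 : η * (β * (V x + V y)) ≤ δ * (β * (V x + V y)) :=
        mul_le_mul_of_nonneg_right (by linarith) h2
      have h4 := hwP x
      have h5 := hwP y
      simp only [hρ]
      simp only [hδ] at h3
      linarith
    · push Not at hxy
      -- For distant pairs the drift alone contracts, so no common part is needed.
      refine (abs_integral_sub_le_of_le hL hw1 hwint hφi hφ 0 (Measure.zero_le _)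
        (Measure.zero_le _)).trans ?_
      refine mul_le_mul_of_nonneg_left ?_ hL
      have h2 := mul_nonneg hβ0.le (add_nonneg (hV0 x) (hV0 y))
      rw [hsum]
      have h3 : η * (β * (V x + V y)) ≤ δ / 2 * (β * (V x + V y)) :=
        mul_le_mul_of_nonneg_right hηδ h2
      have h6 : 4 * (K + 1) ≤ δ * (V x + V y) := by
        rw [hR, div_lt_iff₀ hδ0] at hxy; linarith
      have h7 : β * (4 * (K + 1)) ≤ β * (δ * (V x + V y)) := mul_le_mul_of_nonneg_left h6 hβ0.le
      have h4 := hwP x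
      have h5 := hwP y
      simp only [hρ]
      simp only [hδ] at h3 h7
      simp only [measureReal_zero, Pi.zero_apply, mul_zero, sub_zero]
      linarith
  have hiter : ∀ A, MeasurableSet A → ∀ n : ℕ, ∀ x y,
      |((P ^ n) x).real A - ((P ^ n) y).real A| ≤ ρ ^ n * (w x + w y) := by
    intro A hA n
    have hint : ∀ n x, Integrable (fun y => ((P ^ n) y).real A) (P x) := fun n x => by
      refine Integrable.of_bound (C := 1)
        ((P ^ n).measurable_coe hA).ennreal_toReal.aestronglyMeasurable
        (ae_of_all _ fun y => ?_)
      rw [Real.norm_of_nonneg measureReal_nonneg]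
      exact measureReal_le_one
    induction n with
    | zero =>
      intro x y
      have hb : ∀ z, 0 ≤ ((P ^ 0) z).real A ∧ ((P ^ 0) z).real A ≤ 1 := fun z =>
        ⟨measureReal_nonneg, measureReal_le_one⟩
      rw [pow_zero ρ, one_mul, abs_le]
      have := hw1 x; have := hw1 y; have := hb x; have := hb y
      constructor <;> linarith
    | succ n ih =>
      intro x y
      rw [real_pow_succ_apply P n x hA, real_pow_succ_apply P n y hA, pow_succ']
      exact hstep _ (hint n) _ (by positivity) ih x y
  have hinvn : ∀ n : ℕ, (P ^ n).Invariant μ := by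
    intro n
    induction n with
    | zero =>
      rw [pow_zero]
      change μ.bind (Kernel.id : Kernel X X) = μ
      exact Measure.id_comp
    | succ n ih => rw [pow_succ]; exact ih.comp hinv
  have hwμ : Integrable w μ := (integrable_const 1).add (hμV.const_mul β)
  have hwμ0 : 0 ≤ ∫ y, w y ∂μ := integral_nonneg fun y => zero_le_one.trans (hw1 y)
  refine ⟨fun x => w x + ∫ y, w y ∂μ, ρ, fun x => by linarith [hw1 x], hρ0, hρ1,
    ae_of_all _ fun x n => ?_⟩
  unfold tvDist
  have : Nonempty {A : Set X // MeasurableSet A} := ⟨⟨∅, MeasurableSet.empty⟩⟩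
  refine ciSup_le fun ⟨A, hA⟩ => ?_
  have hint : Integrable (fun y => ((P ^ n) y).real A) μ :=
    Integrable.of_bound (C := 1) ((P ^ n).measurable_coe hA).ennreal_toReal.aestronglyMeasurable
      (ae_of_all _ fun y => by
        rw [Real.norm_of_nonneg measureReal_nonneg]; exact measureReal_le_one)
  -- Invariance turns the distance to `μ` into an average over starting points `y`; the bound
  -- `hiter` is then integrated in `y`, which uses the integrability of `V` under `μ`.
  have hμA : μ.real A = ∫ y, ((P ^ n) y).real A ∂μ := by
    simp only [measureReal_def]
    rw [integral_toReal ((P ^ n).measurable_coe hA).aemeasurable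
      (ae_of_all _ fun y => measure_lt_top _ _), ← Measure.bind_apply hA (P ^ n).aemeasurable,
      (hinvn n).def]
  have hdiff : ((P ^ n) x).real A - μ.real A =
      ∫ y, (((P ^ n) x).real A - ((P ^ n) y).real A) ∂μ := by
    rw [integral_sub (integrable_const _) hint, ← hμA]; simp
  rw [hdiff]
  calc |∫ y, (((P ^ n) x).real A - ((P ^ n) y).real A) ∂μ|
      ≤ ∫ y, |((P ^ n) x).real A - ((P ^ n) y).real A| ∂μ := abs_integral_le_integral_abs
    _ ≤ ∫ y, ρ ^ n * (w x + w y) ∂μ :=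
        integral_mono ((integrable_const _).sub hint).abs
          (((integrable_const _).add hwμ).const_mul _) fun y => hiter A hA n x y
    _ = (w x + ∫ y, w y ∂μ) * ρ ^ n := by
        rw [integral_const_mul, integral_add (integrable_const _) hwμ]
        simp [mul_comm]

end Harris

/-! ### The Metropolis kernel: accepted density, invariance, minorization -/

lemma LocBoundedAway.pos {f : ℝ → ℝ} (hf : LocBoundedAway f) (x : ℝ) : 0 < f x := by
  obtain ⟨a, b, ha, h⟩ := hf {x} isCompact_singleton
  exact ha.trans_le (h x rfl).1

section Kernel

variable {π Ginv : ℝ → ℝ} {h : ℝ}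

lemma coe_propVar (hGpos : ∀ x, 0 < Ginv x) (hh : 0 < h) (x : ℝ) :
    (propVar Ginv h x : ℝ) = h * Ginv x :=
  Real.coe_toNNReal _ (mul_pos hh (hGpos x)).le

lemma propVar_ne_zero (hGpos : ∀ x, 0 < Ginv x) (hh : 0 < h) (x : ℝ) : propVar Ginv h x ≠ 0 :=
  (Real.toNNReal_pos.2 (mul_pos hh (hGpos x))).ne'

lemma propDensity_pos (hGpos : ∀ x, 0 < Ginv x) (hh : 0 < h) (x y : ℝ) :
    0 < propDensity Ginv h x y :=
  gaussianPDFReal_pos _ _ _ (propVar_ne_zero hGpos hh x)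

lemma accept_nonneg (hπpos : ∀ x, 0 < π x) (x y : ℝ) : 0 ≤ accept π Ginv h x y :=
  le_min zero_le_one (div_nonneg (mul_nonneg (hπpos y).le (gaussianPDFReal_nonneg _ _ _))
    (mul_nonneg (hπpos x).le (gaussianPDFReal_nonneg _ _ _)))

lemma accept_le_one (x y : ℝ) : accept π Ginv h x y ≤ 1 := min_le_left _ _

/-- Density of the accepted moves. -/
noncomputable def moveDensity (π Ginv : ℝ → ℝ) (h x y : ℝ) : ℝ :=
  accept π Ginv h x y * propDensity Ginv h x y

/-- Multiplying by `π x` makes the right-hand side symmetric in `x` and `y`. The form is also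
monotone in the ratio `π y / π x`, which later allows comparison of targets. -/
lemma moveDensity_eq_min (hπpos : ∀ x, 0 < π x) (hGpos : ∀ x, 0 < Ginv x) (hh : 0 < h) (x y : ℝ) :
    moveDensity π Ginv h x y =
      min (propDensity Ginv h x y) (π y / π x * propDensity Ginv h y x) := by
  have hq := propDensity_pos hGpos hh x y
  have := (hπpos x).ne'
  rw [moveDensity, accept, min_mul_of_nonneg _ _ hq.le, one_mul]
  congr 1
  field_simp

lemma moveDensity_nonneg (hπpos : ∀ x, 0 < π x) (x y : ℝ) : 0 ≤ moveDensity π Ginv h x y :=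
  mul_nonneg (accept_nonneg hπpos x y) (gaussianPDFReal_nonneg _ _ _)

lemma moveDensity_le (x y : ℝ) : moveDensity π Ginv h x y ≤ propDensity Ginv h x y :=
  mul_le_of_le_one_left (gaussianPDFReal_nonneg _ _ _) (accept_le_one x y)

lemma measurable_moveDensity (hπ : Measurable π) (hG : Measurable Ginv) (h : ℝ) :
    Measurable (fun z : ℝ × ℝ => moveDensity π Ginv h z.1 z.2) :=
  (measurable_accept hπ hG h).mul (measurable_propDensity hG h)

lemma measurable_moveDensity_right (hπ : Measurable π) (hG : Measurable Ginv) (h x : ℝ) :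
    Measurable (moveDensity π Ginv h x) :=
  (measurable_moveDensity hπ hG h).comp measurable_prodMk_left

/-- Detailed balance. -/
lemma mul_moveDensity_comm (hπpos : ∀ x, 0 < π x) (hGpos : ∀ x, 0 < Ginv x) (hh : 0 < h)
    (x y : ℝ) : π x * moveDensity π Ginv h x y = π y * moveDensity π Ginv h y x := by
  have hx := (hπpos x).ne'
  have hy := (hπpos y).ne'
  rw [moveDensity_eq_min hπpos hGpos hh, moveDensity_eq_min hπpos hGpos hh,
    mul_min_of_nonneg _ _ (hπpos x).le, mul_min_of_nonneg _ _ (hπpos y).le, min_comm]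
  congr 1 <;> field_simp

lemma withDensity_accept (hπ : Measurable π) (hG : Measurable Ginv)
    (hGpos : ∀ x, 0 < Ginv x) (hh : 0 < h) (x : ℝ) :
    (gaussianReal x (propVar Ginv h x)).withDensity
        (fun y => ENNReal.ofReal (accept π Ginv h x y)) =
      volume.withDensity fun y => ENNReal.ofReal (moveDensity π Ginv h x y) := by
  rw [gaussianReal_of_var_ne_zero x (propVar_ne_zero hGpos hh x),
    ← withDensity_mul _ (measurable_gaussianPDF _ _)
      ((measurable_accept_ofReal hπ hG h).of_uncurry_left (x := x))]
  congr 1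
  ext y
  rw [Pi.mul_apply, gaussianPDF, ← ENNReal.ofReal_mul (gaussianPDFReal_nonneg _ _ _), moveDensity,
    mul_comm]
  rfl

lemma reject_eq (hπ : Measurable π) (hG : Measurable Ginv)
    (hGpos : ∀ x, 0 < Ginv x) (hh : 0 < h) (x : ℝ) :
    reject π Ginv h x = 1 - ∫⁻ y, ENNReal.ofReal (moveDensity π Ginv h x y) := by
  have := congrArg (fun μ : Measure ℝ => μ Set.univ) (withDensity_accept hπ hG hGpos hh x)
  simp only [withDensity_apply _ MeasurableSet.univ, Measure.restrict_univ] at this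
  rw [reject, this]

lemma kernel_apply_eq (hπ : Measurable π) (hG : Measurable Ginv)
    (hGpos : ∀ x, 0 < Ginv x) (hh : 0 < h) (x : ℝ) :
    kernel π Ginv hπ hG h x =
      volume.withDensity (fun y => ENNReal.ofReal (moveDensity π Ginv h x y)) +
        reject π Ginv h x • Measure.dirac x := by
  rw [← withDensity_accept hπ hG hGpos hh x]
  rfl

lemma integrable_moveDensity (hπ : Measurable π) (hG : Measurable Ginv) (hπpos : ∀ x, 0 < π x)
    (x : ℝ) : Integrable (moveDensity π Ginv h x) := by
  refine (integrable_gaussianPDFReal x (propVar Ginv h x)).mono'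
    (measurable_moveDensity_right hπ hG h x).aestronglyMeasurable (ae_of_all _ fun y => ?_)
  rw [Real.norm_of_nonneg (moveDensity_nonneg hπpos x y)]
  exact moveDensity_le x y

lemma lintegral_moveDensity_le_one (hGpos : ∀ x, 0 < Ginv x) (hh : 0 < h) (x : ℝ) :
    ∫⁻ y, ENNReal.ofReal (moveDensity π Ginv h x y) ≤ 1 := by
  calc _ ≤ ∫⁻ y, gaussianPDF x (propVar Ginv h x) y :=
        lintegral_mono fun y => ENNReal.ofReal_le_ofReal (moveDensity_le x y)
    _ = 1 := lintegral_gaussianPDF_eq_one x (propVar_ne_zero hGpos hh x)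

lemma toReal_reject (hπ : Measurable π) (hG : Measurable Ginv) (hπpos : ∀ x, 0 < π x)
    (hGpos : ∀ x, 0 < Ginv x) (hh : 0 < h) (x : ℝ) :
    (reject π Ginv h x).toReal = 1 - ∫ y, moveDensity π Ginv h x y := by
  rw [reject_eq hπ hG hGpos hh, ENNReal.toReal_sub_of_le
    (lintegral_moveDensity_le_one hGpos hh x) ENNReal.one_ne_top,
    integral_eq_lintegral_of_nonneg_ae (ae_of_all _ fun y => moveDensity_nonneg hπpos x y)
      (measurable_moveDensity_right hπ hG h x).aestronglyMeasurable]
  rfl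

lemma reject_le_one (x : ℝ) : reject π Ginv h x ≤ 1 := tsub_le_self

lemma integrable_mul_moveDensity (hπ : Measurable π) (hG : Measurable Ginv) (hπpos : ∀ x, 0 < π x)
    (hGpos : ∀ x, 0 < Ginv x) (hh : 0 < h) {x : ℝ} {f : ℝ → ℝ} (hfm : Measurable f)
    (hf : Integrable f (gaussianReal x (propVar Ginv h x))) :
    Integrable fun y => f y * moveDensity π Ginv h x y := by
  rw [gaussianReal_of_var_ne_zero x (propVar_ne_zero hGpos hh x),
    integrable_withDensity_iff (measurable_gaussianPDF _ _)
      (ae_of_all _ fun y => gaussianPDF_lt_top)] at hf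
  refine hf.mono (hfm.mul (measurable_moveDensity_right hπ hG h x)).aestronglyMeasurable
    (ae_of_all _ fun y => ?_)
  rw [norm_mul, norm_mul, toReal_gaussianPDF, Real.norm_of_nonneg (moveDensity_nonneg hπpos x y),
    Real.norm_of_nonneg (gaussianPDFReal_nonneg _ _ _)]
  exact mul_le_mul_of_nonneg_left (moveDensity_le x y) (norm_nonneg _)

lemma integrable_kernel (hπ : Measurable π) (hG : Measurable Ginv) (hπpos : ∀ x, 0 < π x)
    (hGpos : ∀ x, 0 < Ginv x) (hh : 0 < h) {x : ℝ} {f : ℝ → ℝ} (hfm : Measurable f)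
    (hf : Integrable f (gaussianReal x (propVar Ginv h x))) :
    Integrable f (kernel π Ginv hπ hG h x) := by
  rw [kernel_apply_eq hπ hG hGpos hh]
  refine Integrable.add_measure ?_ ?_
  · rw [integrable_withDensity_iff (measurable_moveDensity_right hπ hG h x).ennreal_ofReal
      (ae_of_all _ fun y => ENNReal.ofReal_lt_top)]
    simpa only [ENNReal.toReal_ofReal (moveDensity_nonneg hπpos x _)] using
      integrable_mul_moveDensity hπ hG hπpos hGpos hh hfm hf
  · refine Integrable.smul_measure ?_ ((reject_le_one x).trans_lt ENNReal.one_lt_top).ne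
    exact integrable_dirac (by simp [enorm_lt_top])

/-- The increment of a function over one step of the chain. -/
lemma integral_kernel (hπ : Measurable π) (hG : Measurable Ginv) (hπpos : ∀ x, 0 < π x)
    (hGpos : ∀ x, 0 < Ginv x) (hh : 0 < h) {x : ℝ} {f : ℝ → ℝ} (hfm : Measurable f)
    (hf : Integrable f (gaussianReal x (propVar Ginv h x))) :
    ∫ y, f y ∂(kernel π Ginv hπ hG h x) = f x + ∫ y, (f y - f x) * moveDensity π Ginv h x y := by
  have hi := integrable_kernel hπ hG hπpos hGpos hh hfm hf
  rw [kernel_apply_eq hπ hG hGpos hh] at hi ⊢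
  obtain ⟨hi1, hi2⟩ := integrable_add_measure.1 hi
  rw [integral_add_measure hi1 hi2, integral_smul_measure, integral_dirac,
    toReal_reject hπ hG hπpos hGpos hh, integral_withDensity_eq_integral_toReal_smul
      (measurable_moveDensity_right hπ hG h x).ennreal_ofReal
      (ae_of_all _ fun y => ENNReal.ofReal_lt_top)]
  simp only [ENNReal.toReal_ofReal (moveDensity_nonneg hπpos x _), sub_mul, smul_eq_mul]
  rw [integral_sub (integrable_mul_moveDensity hπ hG hπpos hGpos hh hfm hf)
    ((integrable_moveDensity hπ hG hπpos x).const_mul _), integral_const_mul]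
  simp only [mul_comm (moveDensity π Ginv h x _)]
  ring

/-- A crude bound that needs no information on acceptance; it handles the drift condition on a
compact set. -/
lemma integral_kernel_le (hπ : Measurable π) (hG : Measurable Ginv) (hπpos : ∀ x, 0 < π x)
    (hGpos : ∀ x, 0 < Ginv x) (hh : 0 < h) {x : ℝ} {f : ℝ → ℝ} (hf0 : ∀ y, 0 ≤ f y)
    (hfm : Measurable f) (hf : Integrable f (gaussianReal x (propVar Ginv h x))) :
    ∫ y, f y ∂(kernel π Ginv hπ hG h x) ≤
      f x + ∫ y, f y ∂(gaussianReal x (propVar Ginv h x)) := by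
  rw [integral_kernel hπ hG hπpos hGpos hh hfm hf]
  have h1 := integrable_mul_moveDensity hπ hG hπpos hGpos hh hfm hf
  have h2 := (integrable_moveDensity (Ginv := Ginv) (h := h) hπ hG hπpos x).const_mul (f x)
  have hf' := hf
  rw [gaussianReal_of_var_ne_zero x (propVar_ne_zero hGpos hh x),
    integrable_withDensity_iff (measurable_gaussianPDF _ _)
      (ae_of_all _ fun y => gaussianPDF_lt_top)] at hf'
  rw [integral_gaussianReal_eq_integral_smul (propVar_ne_zero hGpos hh x)]
  refine add_le_add_right (integral_mono (by simp only [sub_mul]; exact h1.sub h2)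
    (by simpa only [toReal_gaussianPDF, smul_eq_mul, mul_comm] using hf') fun y => ?_) _
  have h3 := moveDensity_nonneg (Ginv := Ginv) (h := h) hπpos x y
  have h4 : moveDensity π Ginv h x y ≤ gaussianPDFReal x (propVar Ginv h x) y := moveDensity_le x y
  have h5 := mul_nonneg (hf0 x) h3
  have h6 := mul_le_mul_of_nonneg_left h4 (hf0 y)
  simp only [smul_eq_mul]
  linarith

/-- By Tonelli and detailed balance, the accepted flow from everywhere into `s` equals the accepted
flow from `s` to everywhere. Adding the mass rejected within `s` restores the mass of `s`. -/
lemma kernel_invariant (hπ : Measurable π) (hG : Measurable Ginv) (hπpos : ∀ x, 0 < π x)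
    (hGpos : ∀ x, 0 < Ginv x) (hh : 0 < h) :
    (kernel π Ginv hπ hG h).Invariant (target π) := by
  refine Measure.ext fun s hs => ?_
  have hm : Measurable fun z : ℝ × ℝ => ENNReal.ofReal (moveDensity π Ginv h z.1 z.2) :=
    (measurable_moveDensity hπ hG h).ennreal_ofReal
  have hmr : ∀ x, Measurable fun y => ENNReal.ofReal (moveDensity π Ginv h x y) := fun x =>
    (measurable_moveDensity_right hπ hG h x).ennreal_ofReal
  have hP := (kernel π Ginv hπ hG h).measurable_coe hs
  rw [Measure.bind_apply hs (kernel π Ginv hπ hG h).aemeasurable, target,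
    lintegral_withDensity_eq_lintegral_mul _ hπ.ennreal_ofReal hP, withDensity_apply _ hs]
  have hexp : ∀ x, kernel π Ginv hπ hG h x s =
      (∫⁻ y in s, ENNReal.ofReal (moveDensity π Ginv h x y)) +
        s.indicator (reject π Ginv h) x := fun x => by
    rw [kernel_apply_eq hπ hG hGpos hh, Measure.add_apply, withDensity_apply _ hs,
      Measure.smul_apply, Measure.dirac_apply' _ hs]
    by_cases hx : x ∈ s <;> simp [hx]
  have hI : Measurable fun x => ∫⁻ y in s, ENNReal.ofReal (moveDensity π Ginv h x y) :=
    hm.lintegral_prod_right'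
  simp only [Pi.mul_apply, hexp, mul_add]
  have hπI : Measurable fun x => ENNReal.ofReal (π x) *
      ∫⁻ y in s, ENNReal.ofReal (moveDensity π Ginv h x y) := hπ.ennreal_ofReal.mul hI
  have hπJ : Measurable fun x => ENNReal.ofReal (π x) *
      ∫⁻ y, ENNReal.ofReal (moveDensity π Ginv h x y) :=
    hπ.ennreal_ofReal.mul hm.lintegral_prod_right'
  rw [lintegral_add_left hπI]
  have hsecond : ∫⁻ x, ENNReal.ofReal (π x) * s.indicator (reject π Ginv h) x =
      ∫⁻ x in s, ENNReal.ofReal (π x) * reject π Ginv h x := by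
    rw [← lintegral_indicator hs]
    refine lintegral_congr fun x => ?_
    by_cases hx : x ∈ s <;> simp [hx]
  have hfirst : ∫⁻ x, ENNReal.ofReal (π x) *
        ∫⁻ y in s, ENNReal.ofReal (moveDensity π Ginv h x y) =
      ∫⁻ y in s, ENNReal.ofReal (π y) * ∫⁻ x, ENNReal.ofReal (moveDensity π Ginv h y x) := by
    simp only [← lintegral_const_mul _ (hmr _)]
    rw [lintegral_lintegral_swap
      ((hπ.ennreal_ofReal.comp measurable_fst).mul hm).aemeasurable]
    refine lintegral_congr fun y => lintegral_congr fun x => ?_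
    rw [← ENNReal.ofReal_mul (hπpos x).le, ← ENNReal.ofReal_mul (hπpos y).le,
      mul_moveDensity_comm hπpos hGpos hh]
  rw [hfirst, hsecond, ← lintegral_add_left hπJ]
  refine lintegral_congr fun x => ?_
  rw [← mul_add, reject_eq hπ hG hGpos hh,
    add_tsub_cancel_of_le (lintegral_moveDensity_le_one hGpos hh x), mul_one]

/-- Compact sets are small. -/
lemma exists_minorization (hπ : Measurable π) (hG : Measurable Ginv) (hπloc : LocBoundedAway π)
    (hGloc : LocBoundedAway Ginv) (hh : 0 < h) (r : ℝ) :
    ∃ m : Measure ℝ, m Set.univ ≠ 0 ∧ ∀ x, |x| ≤ r → m ≤ kernel π Ginv hπ hG h x := by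
  -- `1 ≤ R` keeps the interval nondegenerate, so that the minorizing measure is nonzero.
  obtain ⟨R, hRr, hR1⟩ : ∃ R : ℝ, r ≤ R ∧ 1 ≤ R := ⟨max r 1, le_max_left _ _, le_max_right _ _⟩
  obtain ⟨a, b, ha, hab⟩ := hGloc (Set.Icc (-R) R) isCompact_Icc
  obtain ⟨a', b', ha', hab'⟩ := hπloc (Set.Icc (-R) R) isCompact_Icc
  have hq : ∀ x ∈ Set.Icc (-R) R, ∀ y ∈ Set.Icc (-R) R,
      (√(2 * Real.pi * (h * b)))⁻¹ * Real.exp (-(2 * R) ^ 2 / (2 * (h * a))) ≤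
        propDensity Ginv h x y := by
    intro x hx y hy
    rw [propDensity, gaussianPDFReal_def, coe_propVar hGloc.pos hh]
    have hgx := hab x hx
    have hg0 := hGloc.pos x
    dsimp only
    gcongr ?_ * Real.exp ?_
    · gcongr; exact hgx.2
    · rw [neg_div, neg_div, neg_le_neg_iff]
      have hyx : (y - x) ^ 2 ≤ (2 * R) ^ 2 :=
        sq_le_sq' (by linarith [hx.2, hy.1]) (by linarith [hx.1, hy.2])
      exact div_le_div₀ (sq_nonneg _) hyx (by positivity) (by gcongr; exact hgx.1)
  set c := (√(2 * Real.pi * (h * b)))⁻¹ * Real.exp (-(2 * R) ^ 2 / (2 * (h * a))) with hc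
  have h0 : (0 : ℝ) ∈ Set.Icc (-R) R := ⟨by linarith, by linarith⟩
  have hb : 0 < b := ha.trans_le ((hab 0 h0).1.trans (hab 0 h0).2)
  have hb' : 0 < b' := ha'.trans_le ((hab' 0 h0).1.trans (hab' 0 h0).2)
  have hc0 : 0 < c := by positivity
  -- A lower bound for both branches of the minimum in `moveDensity_eq_min`.
  set d := min c (a' / b' * c) with hd
  have hd0 : 0 < d := by positivity
  refine ⟨volume.withDensity ((Set.Icc (-R) R).indicator fun _ => ENNReal.ofReal d), ?_,
    fun x hx => ?_⟩
  · rw [withDensity_apply _ MeasurableSet.univ, Measure.restrict_univ,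
      lintegral_indicator measurableSet_Icc, setLIntegral_const, Real.volume_Icc]
    have : 0 < R := by linarith
    simp [hd0, this]
  · rw [kernel_apply_eq hπ hG hGloc.pos hh]
    refine Measure.le_add_right (withDensity_mono (ae_of_all _ fun y => ?_))
    have hxR : x ∈ Set.Icc (-R) R := abs_le.1 (hx.trans hRr)
    refine Set.indicator_le' (fun y hy => ENNReal.ofReal_le_ofReal ?_) (fun _ _ => zero_le) y
    rw [moveDensity_eq_min hπloc.pos hGloc.pos hh]
    refine min_le_min (hq x hxR y hy) ?_
    have h1 := hab' x hxR
    have h2 := hab' y hy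
    have h3 := hq y hy x hxR
    have := hπloc.pos x
    have := hπloc.pos y
    gcongr
    · exact h2.1
    · exact h1.2

end Kernel

/-! ### The scale-free limit problem -/

lemma abs_rpow_le_one_add_abs {s : ℝ} (hs0 : 0 ≤ s) (hs1 : s ≤ 1) (u : ℝ) :
    |u| ^ s ≤ 1 + |u| := by
  rcases le_total |u| 1 with hu | hu
  · linarith [Real.rpow_le_one (abs_nonneg u) hu hs0, abs_nonneg u]
  · have := Real.rpow_le_rpow_of_exponent_le hu hs1
    rw [Real.rpow_one] at this; linarith

section Profile

/-- Density at `u` of the normal distribution with mean `1` and variance `w`. -/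
noncomputable def unitGaussian (w u : ℝ) : ℝ :=
  (√(2 * Real.pi * w))⁻¹ * Real.exp (-(u - 1) ^ 2 / (2 * w))

lemma unitGaussian_nonneg (w u : ℝ) : 0 ≤ unitGaussian w u := by
  unfold unitGaussian; positivity

lemma unitGaussian_pos {w : ℝ} (hw : 0 < w) (u : ℝ) : 0 < unitGaussian w u := by
  unfold unitGaussian; positivity

lemma measurable_unitGaussian : Measurable fun z : ℝ × ℝ => unitGaussian z.1 z.2 := by
  unfold unitGaussian; fun_prop

lemma measurable_unitGaussian_right (w : ℝ) : Measurable (unitGaussian w) :=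
  measurable_unitGaussian.comp measurable_prodMk_left

lemma continuousAt_unitGaussian {w : ℝ} (hw : 0 < w) (u : ℝ) :
    ContinuousAt (fun w => unitGaussian w u) w := by
  unfold unitGaussian
  have h1 : √(2 * Real.pi * w) ≠ 0 := by positivity
  have h2 : 2 * w ≠ 0 := by positivity
  fun_prop (disch := assumption)

/-- One integrable majorant for all variances near `v`, as dominated convergence requires. -/
lemma unitGaussian_le {v w : ℝ} (hv : 0 < v) (h1 : v / 2 ≤ w) (h2 : w ≤ 2 * v) (u : ℝ) :
    unitGaussian w u ≤ 2 * unitGaussian (2 * v) u := by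
  have hw : 0 < w := by linarith
  unfold unitGaussian
  rw [← mul_assoc]
  gcongr ?_ * Real.exp ?_
  · have : 2 * (√(2 * Real.pi * (2 * v)))⁻¹ = (√(2 * Real.pi * (v / 2)))⁻¹ := by
      have h4 : 2 * Real.pi * (2 * v) = 2 ^ 2 * (2 * Real.pi * (v / 2)) := by ring
      rw [h4, Real.sqrt_mul (by positivity), Real.sqrt_sq (by norm_num)]
      field_simp
    rw [this]
    gcongr
  · rw [neg_div, neg_div, neg_le_neg_iff]
    gcongr

/-- For `u ≥ 1` the point `u⁻¹` is at least as close to the mean `1` as `u` is. -/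
lemma unitGaussian_inv_ge (w : ℝ) (hw : 0 < w) {u : ℝ} (hu : 1 ≤ u) :
    unitGaussian w u ≤ unitGaussian w u⁻¹ := by
  unfold unitGaussian
  gcongr ?_ * Real.exp ?_
  rw [neg_div, neg_div, neg_le_neg_iff]
  have h1 : u⁻¹ ≤ 1 := inv_le_one_of_one_le₀ hu
  have h2 : 1 ≤ u⁻¹ * u := by rw [inv_mul_cancel₀ (by positivity)]
  have h3 : 0 < u⁻¹ := by positivity
  have : (u⁻¹ - 1) ^ 2 ≤ (u - 1) ^ 2 := sq_le_sq' (by nlinarith [sq_nonneg (u - 1)]) (by linarith)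
  gcongr

lemma integrable_unitGaussian {w : ℝ} (hw : 0 < w) :
    Integrable fun u => (2 + |u|) * unitGaussian w u := by
  have hb : 0 < 1 / (2 * w) := by positivity
  have h1 := integrable_exp_neg_mul_sq hb
  have h2 := (integrable_mul_exp_neg_mul_sq hb).norm
  have h3 := (((h1.const_mul 3).add h2).const_mul (√(2 * Real.pi * w))⁻¹).comp_sub_right 1
  refine h3.mono' (by
    exact ((measurable_const.add measurable_id.abs).mul
      (measurable_unitGaussian_right w)).aestronglyMeasurable) (ae_of_all _ fun u => ?_)
  rw [Real.norm_of_nonneg (mul_nonneg (by positivity) (unitGaussian_nonneg _ _))]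
  simp only [Pi.add_apply, norm_mul, Real.norm_eq_abs, Real.abs_exp, ← add_mul, unitGaussian]
  have h4 : |u| ≤ 1 + |u - 1| := by
    calc |u| = |1 + (u - 1)| := by ring_nf
      _ ≤ |1| + |u - 1| := abs_add_le _ _
      _ = 1 + |u - 1| := by rw [abs_one]
  have h5 : -(u - 1) ^ 2 / (2 * w) = -(1 / (2 * w)) * (u - 1) ^ 2 := by ring
  rw [h5]
  calc _ = (√(2 * Real.pi * w))⁻¹ *
        ((2 + |u|) * Real.exp (-(1 / (2 * w)) * (u - 1) ^ 2)) := by ring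
    _ ≤ _ := by
      refine mul_le_mul_of_nonneg_left (mul_le_mul_of_nonneg_right ?_ (Real.exp_pos _).le)
        (by positivity)
      linarith

/-- The relative proposal density with the acceptance probability of the target `|x|^{-p}`. -/
noncomputable def profile (p v u : ℝ) : ℝ :=
  min (unitGaussian v u) (u ^ (-p - 1) * unitGaussian v u⁻¹)

lemma profile_nonneg (p v : ℝ) {u : ℝ} (hu : 0 < u) : 0 ≤ profile p v u :=
  le_min (unitGaussian_nonneg _ _) (mul_nonneg (by positivity) (unitGaussian_nonneg _ _))

lemma profile_le (p v u : ℝ) : profile p v u ≤ unitGaussian v u := min_le_left _ _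

lemma measurable_profile (p v : ℝ) : Measurable (profile p v) :=
  (measurable_unitGaussian_right v).min ((measurable_id.pow_const _).mul
    ((measurable_unitGaussian_right v).comp measurable_inv))

/-- Detailed balance for the profile, with respect to `u^{-p} du`. -/
lemma profile_inv (p v : ℝ) {u : ℝ} (hu : 0 < u) :
    profile p v u⁻¹ = u ^ (p + 1) * profile p v u := by
  unfold profile
  rw [mul_min_of_nonneg _ _ (by positivity), inv_inv, ← mul_assoc, ← Real.rpow_add hu, min_comm,
    Real.inv_rpow hu.le, ← Real.rpow_neg hu.le]
  ring_nf
  simp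

lemma integrableOn_rpow_mul_profile (p : ℝ) {v t : ℝ} (hv : 0 < v) (ht0 : 0 ≤ t) (ht1 : t ≤ 1) :
    IntegrableOn (fun u => u ^ t * profile p v u) (Set.Ioi 0) := by
  refine Integrable.mono' (integrable_unitGaussian hv).integrableOn
    ((measurable_id.pow_const _).mul (measurable_profile p v)).aestronglyMeasurable ?_
  filter_upwards [ae_restrict_mem measurableSet_Ioi] with u hu
  have hu : 0 < u := hu
  rw [Real.norm_of_nonneg (mul_nonneg (by positivity) (profile_nonneg p v hu))]
  have h1 := abs_rpow_le_one_add_abs ht0 ht1 u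
  rw [abs_of_pos hu] at h1 ⊢
  exact mul_le_mul (by linarith) (profile_le p v u) (profile_nonneg p v hu) (by linarith)

/-- Inversion carries `(u^s - 1)` to `(u^s - u^(2s))` against the same profile, because `p - 1 =
2s`. The sum of the two forms is `-(u^s - 1)²`. The bound `p ≤ 2` ensures `u^(2s) ≤ 1 + u`, hence
integrability. -/
lemma integral_profile_symm {p v : ℝ} (hv : 0 < v) (hp1 : 1 < p) (hp2 : p ≤ 2) :
    2 * ∫ u in Set.Ioi 0, (u ^ ((p - 1) / 2) - 1) * profile p v u =
      -∫ u in Set.Ioi 0, (u ^ ((p - 1) / 2) - 1) ^ 2 * profile p v u := by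
  set s := (p - 1) / 2 with hs
  have h0 : IntegrableOn (fun u => profile p v u) (Set.Ioi 0) := by
    simpa using integrableOn_rpow_mul_profile p hv le_rfl zero_le_one
  have h1 := integrableOn_rpow_mul_profile p hv (t := s) (by linarith) (by linarith)
  have h2 := integrableOn_rpow_mul_profile p hv (t := p - 1) (by linarith) (by linarith)
  have hI : ∫ u in Set.Ioi 0, (u ^ s - 1) * profile p v u =
      ∫ u in Set.Ioi 0, (u ^ s - u ^ (p - 1)) * profile p v u := by
    -- The substitution `u ↦ u⁻¹`, with Jacobian `u^(-2)`; `profile_inv` supplies the factor `u^(p +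
    -- 1)`.
    rw [← integral_comp_rpow_Ioi _ (p := -1) (by norm_num)]
    refine setIntegral_congr_fun measurableSet_Ioi fun u hu => ?_
    have hu : 0 < u := hu
    simp only [smul_eq_mul, Real.rpow_neg_one]
    rw [profile_inv p v hu, Real.inv_rpow hu.le, ← Real.rpow_neg hu.le]
    have e1 : u ^ ((-1 : ℝ) - 1) * u ^ (p + 1) = u ^ (p - 1) := by
      rw [← Real.rpow_add hu]; ring_nf
    have e2 : u ^ (p - 1) * u ^ (-s) = u ^ s := by
      rw [← Real.rpow_add hu, hs]; ring_nf
    calc |(-1 : ℝ)| * u ^ ((-1 : ℝ) - 1) * ((u ^ (-s) - 1) * (u ^ (p + 1) * profile p v u))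
        = (u ^ ((-1 : ℝ) - 1) * u ^ (p + 1)) * (u ^ (-s) - 1) * profile p v u := by
          rw [abs_neg, abs_one]; ring
      _ = (u ^ (p - 1) * u ^ (-s) - u ^ (p - 1)) * profile p v u := by rw [e1]; ring
      _ = _ := by rw [e2]
  rw [two_mul]
  nth_rewrite 2 [hI]
  rw [← integral_add, ← integral_neg]
  · refine setIntegral_congr_fun measurableSet_Ioi fun u hu => ?_
    have hu : 0 < u := hu
    have : u ^ (p - 1) = (u ^ s) ^ 2 := by
      rw [← Real.rpow_natCast, ← Real.rpow_mul hu.le, hs]; norm_num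
    simp only [this]
    ring
  · simp only [sub_mul, one_mul]; exact h1.sub h0
  · simp only [sub_mul]; exact h1.sub h2

/-- Relative drift of `|x|^{(p-1)/2}` far out in the tails, for the target `|x|^{-p}`; moves across
the origin are accounted for by an upper bound. -/
noncomputable def limitDrift (p v u : ℝ) : ℝ :=
  if u ≤ 0 then max (|u| ^ ((p - 1) / 2) - 1) 0 * unitGaussian v u
  else (u ^ ((p - 1) / 2) - 1) * profile p v u

lemma measurable_limitDrift (p v : ℝ) : Measurable (limitDrift p v) :=
  Measurable.ite measurableSet_Iic
    ((((measurable_id.abs.pow_const _).sub_const 1).max measurable_const).mul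
      (measurable_unitGaussian_right v))
    (((measurable_id.pow_const _).sub_const 1).mul (measurable_profile p v))

lemma abs_max_sub_one_le {s : ℝ} (hs0 : 0 ≤ s) (hs1 : s ≤ 1) (u : ℝ) :
    |(|u| ^ s - 1)| ≤ 2 + |u| ∧ |max (|u| ^ s - 1) 0| ≤ 2 + |u| := by
  have h1 := abs_rpow_le_one_add_abs hs0 hs1 u
  have h2 : 0 ≤ |u| ^ s := by positivity
  have h3 := abs_nonneg u
  refine ⟨abs_le.2 ⟨by linarith, by linarith⟩, ?_⟩
  rw [abs_of_nonneg (le_max_right _ _)]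
  exact max_le (by linarith) (by linarith)

lemma integrable_limitDrift {p v : ℝ} (hv : 0 < v) (hp1 : 1 < p) (hp2 : p ≤ 2) :
    Integrable (limitDrift p v) := by
  refine (integrable_unitGaussian hv).mono' (measurable_limitDrift p v).aestronglyMeasurable
    (ae_of_all _ fun u => ?_)
  have hb := abs_max_sub_one_le (s := (p - 1) / 2) (by linarith) (by linarith) u
  rw [limitDrift, Real.norm_eq_abs]
  split_ifs with hu
  · rw [abs_mul, abs_of_nonneg (unitGaussian_nonneg v u)]
    exact mul_le_mul_of_nonneg_right hb.2 (unitGaussian_nonneg v u)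
  · push Not at hu
    rw [abs_mul, abs_of_nonneg (profile_nonneg p v hu)]
    have := hb.1
    rw [abs_of_pos hu] at this ⊢
    exact mul_le_mul this (profile_le p v u) (profile_nonneg p v hu) (by linarith)

/-- Only `u < -1` contributes, at distance more than `2` from the mean, whereas `u = 2` lies at
distance `1`. The bound is expressed through `unitGaussian v 2` so that it can be compared with
`le_setIntegral_sq_mul_profile`. -/
lemma setIntegral_Iic_limitDrift_le {p v : ℝ} (hv : 0 < v) (hv1 : v ≤ 1) (hp1 : 1 < p)
    (hp2 : p ≤ 2) :
    ∫ u in Set.Iic 0, limitDrift p v u ≤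
      unitGaussian v 2 * Real.exp (-1 / v) *
        ∫ w in Set.Ioi (0 : ℝ), w * Real.exp (-(1 / 2) * w ^ 2) := by
  have h1 : ∫ u in Set.Iic 0, limitDrift p v u =
      ∫ w in Set.Ioi (0 : ℝ), limitDrift p v (-w) := by
    have := integral_comp_neg_Ioi (0 : ℝ) (limitDrift p v)
    rw [neg_zero] at this
    exact this.symm
  rw [h1, ← integral_const_mul]
  refine setIntegral_mono_on (integrable_limitDrift hv hp1 hp2).comp_neg.integrableOn
    ((integrable_mul_exp_neg_mul_sq (by norm_num)).const_mul _).integrableOn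
    measurableSet_Ioi fun w hw => ?_
  have hw : 0 < w := hw
  rw [limitDrift, if_pos (by linarith), abs_neg, abs_of_pos hw]
  rcases le_total w 1 with hw1 | hw1
  · have : w ^ ((p - 1) / 2) ≤ 1 := Real.rpow_le_one hw.le hw1 (by linarith)
    rw [max_eq_right (by linarith), zero_mul]
    have := unitGaussian_nonneg v 2
    positivity
  · have h2 := abs_rpow_le_one_add_abs (s := (p - 1) / 2) (by linarith) (by linarith) w
    rw [abs_of_pos hw] at h2
    have h3 : unitGaussian v (-w) ≤
        unitGaussian v 2 * Real.exp (-1 / v) * Real.exp (-(1 / 2) * w ^ 2) := by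
      unfold unitGaussian
      rw [mul_assoc _ (Real.exp _), mul_assoc _ (Real.exp _), ← Real.exp_add, ← Real.exp_add]
      gcongr
      have h4 : w ^ 2 ≤ w ^ 2 / v := by
        rw [le_div_iff₀ hv]; exact mul_le_of_le_one_right (by positivity) hv1
      -- Of the `3`, one unit makes `unitGaussian v 2` and two make `exp (-1 / v)`; the `w ^ 2` is
      -- left for convergence.
      have h5 : (w ^ 2 + 3) / (2 * v) ≤ (-w - 1) ^ 2 / (2 * v) := by gcongr; nlinarith
      have h6 : (w ^ 2 + 3) / (2 * v) = w ^ 2 / v / 2 + 3 / (2 * v) := by field_simp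
      have h7 : -(2 - 1) ^ 2 / (2 * v) + (-1 / v) = -(3 / (2 * v)) := by field_simp; norm_num
      have h8 : -(-w - 1) ^ 2 / (2 * v) = -((-w - 1) ^ 2 / (2 * v)) := neg_div _ _
      rw [h8]
      linarith
    calc _ ≤ w * (unitGaussian v 2 * Real.exp (-1 / v) * Real.exp (-(1 / 2) * w ^ 2)) :=
          mul_le_mul (max_le (by linarith) hw.le) h3 (unitGaussian_nonneg _ _) hw.le
      _ = _ := by ring

/-- On `[3/2, 2]` the square is bounded below and the profile is at least `2^(-p - 1) * unitGaussian
v 2`; the final factor `1/2` is the length of this interval. -/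
lemma le_setIntegral_sq_mul_profile {p v : ℝ} (hv : 0 < v) (hp1 : 1 < p) (hp2 : p ≤ 2) :
    ((3 / 2 : ℝ) ^ ((p - 1) / 2) - 1) ^ 2 * 2 ^ (-p - 1) / 2 * unitGaussian v 2 ≤
      ∫ u in Set.Ioi 0, (u ^ ((p - 1) / 2) - 1) ^ 2 * profile p v u := by
  set s := (p - 1) / 2 with hs
  have h0 : IntegrableOn (fun u => profile p v u) (Set.Ioi 0) := by
    simpa using integrableOn_rpow_mul_profile p hv le_rfl zero_le_one
  have h1 := integrableOn_rpow_mul_profile p hv (t := s) (by linarith) (by linarith)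
  have h2 := integrableOn_rpow_mul_profile p hv (t := p - 1) (by linarith) (by linarith)
  have hint : IntegrableOn (fun u => (u ^ s - 1) ^ 2 * profile p v u) (Set.Ioi 0) := by
    refine ((h2.sub (h1.const_mul 2)).add h0).congr_fun (fun u hu => ?_) measurableSet_Ioi
    have hu : 0 < u := hu
    have : u ^ (p - 1) = (u ^ s) ^ 2 := by
      rw [← Real.rpow_natCast, ← Real.rpow_mul hu.le, hs]; norm_num
    simp only [Pi.add_apply, Pi.sub_apply, this]
    ring
  have hsub : Set.Icc (3 / 2 : ℝ) 2 ⊆ Set.Ioi 0 := fun u hu => by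
    have := hu.1; simp only [Set.mem_Ioi]; linarith
  calc _ = ∫ _ in Set.Icc (3 / 2 : ℝ) 2,
          ((3 / 2 : ℝ) ^ s - 1) ^ 2 * (2 ^ (-p - 1) * unitGaussian v 2) := by
        rw [setIntegral_const, measureReal_def, Real.volume_Icc]
        norm_num
        ring
    _ ≤ ∫ u in Set.Icc (3 / 2 : ℝ) 2, (u ^ s - 1) ^ 2 * profile p v u := by
        refine setIntegral_mono_on (integrableOn_const (by simp))
          (hint.mono_set hsub) measurableSet_Icc fun u hu => ?_
        have hu0 : 0 < u := hsub hu
        have hs0 : 0 < s := by linarith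
        have e1 : (1 : ℝ) ≤ (3 / 2 : ℝ) ^ s := Real.one_le_rpow (by norm_num) hs0.le
        have e2 : (3 / 2 : ℝ) ^ s ≤ u ^ s := Real.rpow_le_rpow (by norm_num) hu.1 hs0.le
        have e3 : (2 : ℝ) ^ (-p - 1) ≤ u ^ (-p - 1) :=
          Real.rpow_le_rpow_of_nonpos hu0 hu.2 (by linarith)
        have e4 : (2 : ℝ) ^ (-p - 1) ≤ 1 :=
          Real.rpow_le_one_of_one_le_of_nonpos (by norm_num) (by linarith)
        have e5 : unitGaussian v 2 ≤ unitGaussian v u := by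
          unfold unitGaussian
          gcongr ?_ * Real.exp ?_
          rw [neg_div, neg_div, neg_le_neg_iff]
          have : (u - 1) ^ 2 ≤ (2 - 1) ^ 2 :=
            sq_le_sq' (by linarith [hu.1]) (by linarith [hu.2])
          gcongr
        have e6 := unitGaussian_inv_ge v hv (u := u) (by linarith [hu.1])
        have e7 := unitGaussian_nonneg v 2
        refine mul_le_mul (pow_le_pow_left₀ (by linarith) (by linarith) 2) (le_min ?_ ?_)
          (by positivity) (by positivity)
        · exact (mul_le_of_le_one_left e7 e4).trans e5
        · exact mul_le_mul e3 (e5.trans e6) e7 (by positivity)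
    _ ≤ _ := setIntegral_mono_set hint
        ((ae_restrict_mem measurableSet_Ioi).mono fun u hu =>
          mul_nonneg (sq_nonneg _) (profile_nonneg p v hu))
        (ae_of_all _ hsub)

/-- For a small relative step size the limiting drift is negative. -/
lemma exists_integral_limitDrift_neg {p : ℝ} (hp1 : 1 < p) (hp2 : p ≤ 2) :
    ∃ v₀ : ℝ, 0 < v₀ ∧ ∀ v, 0 < v → v < v₀ → ∫ u, limitDrift p v u < 0 := by
  set M := ∫ w in Set.Ioi (0 : ℝ), w * Real.exp (-(1 / 2) * w ^ 2) with hM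
  have hM0 : 0 ≤ M := setIntegral_nonneg measurableSet_Ioi fun w hw =>
    mul_nonneg (le_of_lt hw) (Real.exp_pos _).le
  set c := ((3 / 2 : ℝ) ^ ((p - 1) / 2) - 1) ^ 2 * 2 ^ (-p - 1) / 2 with hc
  have hc0 : 0 < c := by
    have : (1 : ℝ) < (3 / 2 : ℝ) ^ ((p - 1) / 2) :=
      Real.one_lt_rpow (by norm_num) (by linarith)
    have : 0 < (3 / 2 : ℝ) ^ ((p - 1) / 2) - 1 := by linarith
    positivity
  -- Since `exp (-1 / v) ≤ v`, this choice makes the crossing term `exp (-1 / v) * M` smaller than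
  -- `c / 2`, the gain from symmetrization, both in units of `unitGaussian v 2`.
  refine ⟨min 1 (c / (2 * (M + 1))), by positivity, fun v hv hvlt => ?_⟩
  have hv1 : v ≤ 1 := hvlt.le.trans (min_le_left _ _)
  have hv2 : v < c / (2 * (M + 1)) := hvlt.trans_le (min_le_right _ _)
  rw [← integral_add_compl (measurableSet_Iic (a := (0 : ℝ))) (integrable_limitDrift hv hp1 hp2),
    Set.compl_Iic]
  have h1 := setIntegral_Iic_limitDrift_le hv hv1 hp1 hp2
  have h2 := le_setIntegral_sq_mul_profile hv hp1 hp2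
  have h3 := integral_profile_symm hv hp1 hp2
  have h4 : ∫ u in Set.Ioi 0, limitDrift p v u =
      ∫ u in Set.Ioi 0, (u ^ ((p - 1) / 2) - 1) * profile p v u :=
    setIntegral_congr_fun measurableSet_Ioi fun u hu => if_neg (not_le.2 hu)
  rw [← h4] at h3
  have h5 : Real.exp (-1 / v) ≤ v := by
    rw [neg_div, Real.exp_neg]
    refine inv_le_of_inv_le₀ hv ?_
    rw [← one_div]
    linarith [Real.add_one_le_exp (1 / v)]
  have h6 := unitGaussian_pos hv 2
  rw [lt_div_iff₀ (by positivity)] at hv2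
  have h7 : Real.exp (-1 / v) * M ≤ v * M := mul_le_mul_of_nonneg_right h5 hM0
  have h8 : Real.exp (-1 / v) * M < c / 2 := by linarith
  have h9 := mul_lt_mul_of_pos_left h8 h6
  rw [← hM] at h1
  rw [← hc] at h2
  linarith

end Profile

/-! ### Tail drift of the actual chain by rescaling -/

section Drift

variable {π Ginv : ℝ → ℝ} {h : ℝ}

/-- Proposal variance relative to the square of the position. -/
noncomputable def relVar (Ginv : ℝ → ℝ) (h x : ℝ) : ℝ := h * Ginv x / x ^ 2

lemma relVar_pos (hGpos : ∀ x, 0 < Ginv x) (hh : 0 < h) {x : ℝ} (hx : x ≠ 0) :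
    0 < relVar Ginv h x := by
  have := hGpos x
  unfold relVar; positivity

lemma measurable_relVar (hG : Measurable Ginv) (h : ℝ) : Measurable (relVar Ginv h) := by
  unfold relVar; fun_prop

lemma abs_mul_propDensity (hGpos : ∀ x, 0 < Ginv x) (hh : 0 < h) {x : ℝ} (hx : x ≠ 0) (u : ℝ) :
    |x| * propDensity Ginv h x (u * x) = unitGaussian (relVar Ginv h x) u := by
  rw [propDensity, gaussianPDFReal_def, coe_propVar hGpos hh]
  have hw := relVar_pos hGpos hh hx
  have he : h * Ginv x = relVar Ginv h x * x ^ 2 := by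
    unfold relVar; field_simp
  dsimp only
  rw [he, unitGaussian]
  have h1 : √(2 * Real.pi * (relVar Ginv h x * x ^ 2)) = √(2 * Real.pi * relVar Ginv h x) * |x| := by
    rw [← mul_assoc, Real.sqrt_mul (by positivity), Real.sqrt_sq_eq_abs]
  have h2 : -(u * x - x) ^ 2 / (2 * (relVar Ginv h x * x ^ 2)) =
      -(u - 1) ^ 2 / (2 * relVar Ginv h x) := by
    field_simp
  have h3 : |x| ≠ 0 := abs_ne_zero.2 hx
  have h4 : √(2 * Real.pi * relVar Ginv h x) ≠ 0 := by positivity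
  rw [h1, h2]
  field_simp

lemma abs_mul_moveDensity (hπpos : ∀ x, 0 < π x) (hGpos : ∀ x, 0 < Ginv x) (hh : 0 < h)
    {x u : ℝ} (hx : x ≠ 0) (hu : u ≠ 0) :
    |x| * moveDensity π Ginv h x (u * x) =
      min (unitGaussian (relVar Ginv h x) u)
        (π (u * x) / π x * (|u|⁻¹ * unitGaussian (relVar Ginv h (u * x)) u⁻¹)) := by
  rw [moveDensity_eq_min hπpos hGpos hh, mul_min_of_nonneg _ _ (abs_nonneg x),
    abs_mul_propDensity hGpos hh hx, ← abs_mul_propDensity hGpos hh (mul_ne_zero hu hx) u⁻¹,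
    inv_mul_cancel_left₀ hu, abs_mul]
  have := abs_ne_zero.2 hu
  congr 1
  field_simp

/-- Upper bound for the relative drift of `|x|^{(p-1)/2}` at distance at least `x₀`. -/
noncomputable def driftBound (Ginv : ℝ → ℝ) (p x₀ h x u : ℝ) : ℝ :=
  if u ≤ 0 then max (|u| ^ ((p - 1) / 2) - 1) 0 * unitGaussian (relVar Ginv h x) u
  else if |u * x| < x₀ then 0
  else (u ^ ((p - 1) / 2) - 1) * min (unitGaussian (relVar Ginv h x) u)
    (u ^ (-p - 1) * unitGaussian (relVar Ginv h (u * x)) u⁻¹)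

lemma measurable_driftBound (hG : Measurable Ginv) (p x₀ h x : ℝ) :
    Measurable (driftBound Ginv p x₀ h x) := by
  refine Measurable.ite measurableSet_Iic
    ((((measurable_id.abs.pow_const _).sub_const 1).max measurable_const).mul
      (measurable_unitGaussian_right _))
    (Measurable.ite (measurableSet_lt (measurable_id.mul_const x).abs measurable_const)
      measurable_const (((measurable_id.pow_const _).sub_const 1).mul
        ((measurable_unitGaussian_right _).min ((measurable_id.pow_const _).mul ?_))))
  exact measurable_unitGaussian.comp
    (((measurable_relVar hG h).comp (measurable_id.mul_const x)).prodMk measurable_inv)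

lemma abs_driftBound_le {p : ℝ} (hp1 : 1 < p) (hp2 : p ≤ 2) (x₀ x u : ℝ) :
    |driftBound Ginv p x₀ h x u| ≤ (2 + |u|) * unitGaussian (relVar Ginv h x) u := by
  have hb := abs_max_sub_one_le (s := (p - 1) / 2) (by linarith) (by linarith) u
  have hg := unitGaussian_nonneg (relVar Ginv h x) u
  rw [driftBound]
  split_ifs with hu hux
  · rw [abs_mul, abs_of_nonneg hg]
    exact mul_le_mul_of_nonneg_right hb.2 hg
  · rw [abs_zero]
    positivity
  · push Not at hu
    have hm : 0 ≤ min (unitGaussian (relVar Ginv h x) u)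
        (u ^ (-p - 1) * unitGaussian (relVar Ginv h (u * x)) u⁻¹) :=
      le_min hg (mul_nonneg (by positivity) (unitGaussian_nonneg _ _))
    rw [abs_mul, abs_of_nonneg hm]
    have := hb.1
    rw [abs_of_pos hu] at this ⊢
    exact mul_le_mul this (min_le_left _ _) hm (by linarith)

/-- The sign of `u^s - 1` matches the direction of the tail comparison: for `u ≥ 1` acceptance is
bounded above by that of `|x|^{-p}` and multiplies a nonnegative factor, for `u ≤ 1` it is bounded
below and multiplies a nonpositive one. -/
lemma drift_le_driftBound (hπpos : ∀ x, 0 < π x) (hGpos : ∀ x, 0 < Ginv x) (hh : 0 < h)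
    {p x₀ : ℝ} (hp1 : 1 < p) (hx₀ : 0 < x₀)
    (htail : ∀ x u, x₀ ≤ |x| → 1 ≤ u → π (u * x) ≤ u ^ (-p) * π x) {x : ℝ} (hx : x₀ ≤ |x|)
    (u : ℝ) :
    (|u| ^ ((p - 1) / 2) - 1) * (|x| * moveDensity π Ginv h x (u * x)) ≤
      driftBound Ginv p x₀ h x u := by
  have hx0 : x ≠ 0 := abs_pos.1 (hx₀.trans_le hx)
  have hs : 0 ≤ (p - 1) / 2 := by linarith
  have ha0 : 0 ≤ |x| * moveDensity π Ginv h x (u * x) :=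
    mul_nonneg (abs_nonneg _) (moveDensity_nonneg hπpos _ _)
  have ha1 : |x| * moveDensity π Ginv h x (u * x) ≤ unitGaussian (relVar Ginv h x) u := by
    rw [← abs_mul_propDensity hGpos hh hx0]
    exact mul_le_mul_of_nonneg_left (moveDensity_le _ _) (abs_nonneg _)
  rw [driftBound]
  split_ifs with hu hux
  · exact mul_le_mul (le_max_left _ _) ha1 ha0 (le_max_right _ _)
  -- A landing point inside `|y| < x₀` escapes the tail condition, but such a move is inward and may
  -- be bounded by zero.
  · push Not at hu
    have hu1 : |u| ≤ 1 := by
      by_contra hcon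
      push Not at hcon
      rw [abs_mul] at hux
      have := le_mul_of_one_le_left (abs_nonneg x) hcon.le
      linarith
    have := Real.rpow_le_one (abs_nonneg u) hu1 hs
    exact mul_nonpos_of_nonpos_of_nonneg (by linarith) ha0
  · push Not at hu hux
    rw [abs_mul_moveDensity hπpos hGpos hh hx0 hu.ne', abs_of_pos hu, ← mul_assoc]
    have hg := unitGaussian_nonneg (relVar Ginv h (u * x)) u⁻¹
    have hpow : u ^ (-p - 1) = u ^ (-p) * u⁻¹ := by
      rw [Real.rpow_sub hu, Real.rpow_one, div_eq_mul_inv]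
    have hπx := hπpos x
    rcases le_total 1 u with hu1 | hu1
    · have h1 : π (u * x) / π x ≤ u ^ (-p) := by
        rw [div_le_iff₀ hπx]; exact htail x u hx hu1
      have h2 : (1 : ℝ) ≤ u ^ ((p - 1) / 2) := Real.one_le_rpow hu1 hs
      refine mul_le_mul_of_nonneg_left (min_le_min_left _ ?_) (by linarith)
      rw [hpow]
      gcongr
    · have h1 : u ^ (-p) ≤ π (u * x) / π x := by
        rw [le_div_iff₀ hπx]
        -- The tail condition is read outwards from the landing point `u * x` back to `x`.
        have h3 := htail (u * x) u⁻¹ hux ((one_le_inv₀ hu).2 hu1)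
        rw [inv_mul_cancel_left₀ hu.ne', Real.inv_rpow hu.le] at h3
        have h4 : 0 < u ^ (-p) := by positivity
        rwa [inv_mul_eq_div, le_div_iff₀ h4, mul_comm] at h3
      have h2 : u ^ ((p - 1) / 2) ≤ 1 := Real.rpow_le_one hu.le hu1 hs
      refine mul_le_mul_of_nonpos_left (min_le_min_left _ ?_) (by linarith)
      rw [hpow]
      gcongr

lemma tendsto_relVar {C : ℝ} (hC : Tendsto (fun x => Ginv x / |x| ^ 2) (Bornology.cobounded ℝ) (𝓝 C))
    (h : ℝ) : Tendsto (relVar Ginv h) (Bornology.cobounded ℝ) (𝓝 (h * C)) := by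
  have : relVar Ginv h = fun x => h * (Ginv x / |x| ^ 2) := by
    ext x; rw [relVar, sq_abs, mul_div_assoc]
  rw [this]
  exact hC.const_mul h

lemma tendsto_driftBound {v : ℝ} (hv : 0 < v)
    (hw : Tendsto (relVar Ginv h) (Bornology.cobounded ℝ) (𝓝 v)) (p x₀ u : ℝ) :
    Tendsto (fun x => driftBound Ginv p x₀ h x u) (Bornology.cobounded ℝ)
      (𝓝 (limitDrift p v u)) := by
  have h1 : Tendsto (fun x => unitGaussian (relVar Ginv h x) u) (Bornology.cobounded ℝ)
      (𝓝 (unitGaussian v u)) := (continuousAt_unitGaussian hv u).tendsto.comp hw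
  by_cases hu : u ≤ 0
  · simp only [driftBound, limitDrift, if_pos hu]
    exact h1.const_mul _
  · have hu' : u ≠ 0 := fun h => hu h.le
    simp only [driftBound, limitDrift, if_neg hu, profile]
    have hmul := tendsto_mul_left_cobounded hu'
    have h2 : Tendsto (fun x => unitGaussian (relVar Ginv h (u * x)) u⁻¹) (Bornology.cobounded ℝ)
        (𝓝 (unitGaussian v u⁻¹)) :=
      (continuousAt_unitGaussian hv u⁻¹).tendsto.comp (hw.comp hmul)
    have hev : ∀ᶠ x in Bornology.cobounded ℝ, x₀ ≤ |u * x| :=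
      (tendsto_norm_cobounded_atTop.comp hmul).eventually_ge_atTop x₀
    refine ((h1.min (h2.const_mul _)).const_mul _).congr' ?_
    filter_upwards [hev] with x hx
    rw [if_neg (not_lt.2 hx)]

lemma tendsto_integral_driftBound (hG : Measurable Ginv) {v : ℝ} (hv : 0 < v)
    (hw : Tendsto (relVar Ginv h) (Bornology.cobounded ℝ) (𝓝 v)) {p : ℝ} (hp1 : 1 < p)
    (hp2 : p ≤ 2) (x₀ : ℝ) :
    Tendsto (fun x => ∫ u, driftBound Ginv p x₀ h x u) (Bornology.cobounded ℝ)
      (𝓝 (∫ u, limitDrift p v u)) := by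
  have : (Bornology.cobounded ℝ).IsCountablyGenerated := by
    rw [← comap_norm_atTop]; infer_instance
  refine tendsto_integral_filter_of_dominated_convergence
    (fun u => 2 * ((2 + |u|) * unitGaussian (2 * v) u))
    (Eventually.of_forall fun x => (measurable_driftBound hG p x₀ h x).aestronglyMeasurable) ?_
    ((integrable_unitGaussian (by positivity)).const_mul 2)
    (ae_of_all _ fun u => tendsto_driftBound hv hw p x₀ u)
  filter_upwards [hw.eventually_const_le (show v / 2 < v by linarith),
    hw.eventually_le_const (show v < 2 * v by linarith)] with x hx1 hx2
  refine ae_of_all _ fun u => (abs_driftBound_le hp1 hp2 x₀ x u).trans ?_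
  have := mul_le_mul_of_nonneg_left (unitGaussian_le hv hx1 hx2 u)
    (show 0 ≤ 2 + |u| by positivity)
  linarith

/-! ### Drift condition and integrability of the Lyapunov function -/

lemma measurable_abs_rpow (s : ℝ) : Measurable fun x : ℝ => |x| ^ s :=
  measurable_id.abs.pow_const s

lemma integrable_sq_gaussianReal (x : ℝ) (w : ℝ≥0) :
    Integrable (fun y => y ^ 2) (gaussianReal x w) :=
  (memLp_id_gaussianReal 2).integrable_sq

lemma abs_rpow_le_two_add_sq {s : ℝ} (hs0 : 0 ≤ s) (hs1 : s ≤ 1) (y : ℝ) :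
    |y| ^ s ≤ 2 + y ^ 2 := by
  have h1 := abs_rpow_le_one_add_abs hs0 hs1 y
  rw [← sq_abs y]
  nlinarith [sq_nonneg (|y| - 1)]

lemma integrable_abs_rpow_gaussianReal {s : ℝ} (hs0 : 0 ≤ s) (hs1 : s ≤ 1) (x : ℝ) (w : ℝ≥0) :
    Integrable (fun y => |y| ^ s) (gaussianReal x w) := by
  refine ((integrable_const 2).add (integrable_sq_gaussianReal x w)).mono'
    (measurable_abs_rpow s).aestronglyMeasurable (ae_of_all _ fun y => ?_)
  rw [Real.norm_of_nonneg (by positivity)]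
  exact abs_rpow_le_two_add_sq hs0 hs1 y

lemma integral_abs_rpow_gaussianReal_le {s : ℝ} (hs0 : 0 ≤ s) (hs1 : s ≤ 1) (x : ℝ) (w : ℝ≥0) :
    ∫ y, |y| ^ s ∂(gaussianReal x w) ≤ 2 + (x ^ 2 + w) := by
  have hv : ∫ y, y ^ 2 ∂(gaussianReal x w) = x ^ 2 + w := by
    have h1 := variance_eq_sub (μ := gaussianReal x w) (X := id) (memLp_id_gaussianReal 2)
    rw [variance_id_gaussianReal] at h1
    simp only [id, Pi.pow_apply, integral_id_gaussianReal] at h1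
    linarith
  calc ∫ y, |y| ^ s ∂(gaussianReal x w)
      ≤ ∫ y, (2 + y ^ 2) ∂(gaussianReal x w) :=
        integral_mono (integrable_abs_rpow_gaussianReal hs0 hs1 x w)
          ((integrable_const 2).add (integrable_sq_gaussianReal x w))
          fun y => abs_rpow_le_two_add_sq hs0 hs1 y
    _ = _ := by
        rw [integral_add (integrable_const 2) (integrable_sq_gaussianReal x w), hv]; simp

/-- Far out in the tails, one step of the chain acts on `|x|^{(p-1)/2}` through the relative
drift. -/
lemma integral_kernel_abs_rpow_le (hπ : Measurable π) (hG : Measurable Ginv)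
    (hπpos : ∀ x, 0 < π x) (hGpos : ∀ x, 0 < Ginv x) (hh : 0 < h)
    {p x₀ : ℝ} (hp1 : 1 < p) (hp2 : p ≤ 2) (hx₀ : 0 < x₀)
    (htail : ∀ x u, x₀ ≤ |x| → 1 ≤ u → π (u * x) ≤ u ^ (-p) * π x) {x : ℝ} (hx : x₀ ≤ |x|) :
    ∫ y, |y| ^ ((p - 1) / 2) ∂(kernel π Ginv hπ hG h x) ≤
      (1 + ∫ u, driftBound Ginv p x₀ h x u) * |x| ^ ((p - 1) / 2) := by
  set s := (p - 1) / 2 with hs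
  have hs0 : 0 ≤ s := by linarith
  have hs1 : s ≤ 1 := by linarith
  have hx0 : x ≠ 0 := abs_pos.1 (hx₀.trans_le hx)
  have hw := relVar_pos hGpos hh hx0
  rw [integral_kernel hπ hG hπpos hGpos hh (measurable_abs_rpow s)
    (integrable_abs_rpow_gaussianReal hs0 hs1 _ _)]
  have hsub := Measure.integral_comp_mul_right
    (fun y => (|y| ^ s - |x| ^ s) * moveDensity π Ginv h x y) x
  have hcv : ∫ y, (|y| ^ s - |x| ^ s) * moveDensity π Ginv h x y =
      |x| ^ s * ∫ u, (|u| ^ s - 1) * (|x| * moveDensity π Ginv h x (u * x)) := by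
    have hxa := abs_ne_zero.2 hx0
    have h1 : ∫ y, (|y| ^ s - |x| ^ s) * moveDensity π Ginv h x y =
        |x| * ∫ u, (|u * x| ^ s - |x| ^ s) * moveDensity π Ginv h x (u * x) := by
      rw [hsub, abs_inv, smul_eq_mul, mul_inv_cancel_left₀ hxa]
    rw [h1, ← integral_const_mul, ← integral_const_mul]
    refine integral_congr_ae (ae_of_all _ fun u => ?_)
    simp only [abs_mul, Real.mul_rpow (abs_nonneg u) (abs_nonneg x)]
    ring
  have hdom := integrable_unitGaussian hw
  have hle : ∫ u, (|u| ^ s - 1) * (|x| * moveDensity π Ginv h x (u * x)) ≤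
      ∫ u, driftBound Ginv p x₀ h x u := by
    refine integral_mono ?_ ?_ fun u =>
      drift_le_driftBound hπpos hGpos hh hp1 hx₀ htail hx u
    · refine hdom.mono' (((measurable_abs_rpow s).sub_const 1).mul
        (((measurable_moveDensity_right hπ hG h x).comp
          (measurable_id.mul_const x)).const_mul _)).aestronglyMeasurable
        (ae_of_all _ fun u => ?_)
      have ha0 : 0 ≤ |x| * moveDensity π Ginv h x (u * x) :=
        mul_nonneg (abs_nonneg _) (moveDensity_nonneg hπpos _ _)
      rw [Real.norm_eq_abs, abs_mul, abs_of_nonneg ha0]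
      refine mul_le_mul (abs_max_sub_one_le hs0 hs1 u).1 ?_ ha0 (by positivity)
      rw [← abs_mul_propDensity hGpos hh hx0]
      exact mul_le_mul_of_nonneg_left (moveDensity_le _ _) (abs_nonneg _)
    · exact hdom.mono' (measurable_driftBound hG p x₀ h x).aestronglyMeasurable
        (ae_of_all _ fun u => abs_driftBound_le hp1 hp2 x₀ x u)
  rw [hcv]
  have := mul_le_mul_of_nonneg_left hle (show 0 ≤ |x| ^ s by positivity)
  linarith

/-- Foster-Lyapunov drift condition. -/
lemma exists_drift (hπ : Measurable π) (hG : Measurable Ginv) (hπpos : ∀ x, 0 < π x)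
    (hGloc : LocBoundedAway Ginv) (hh : 0 < h) {v : ℝ} (hv : 0 < v)
    (hw : Tendsto (relVar Ginv h) (Bornology.cobounded ℝ) (𝓝 v))
    {p x₀ : ℝ} (hp1 : 1 < p) (hp2 : p ≤ 2) (hx₀ : 0 < x₀)
    (htail : ∀ x u, x₀ ≤ |x| → 1 ≤ u → π (u * x) ≤ u ^ (-p) * π x)
    (hneg : ∫ u, limitDrift p v u < 0) :
    ∃ γ K : ℝ, 0 ≤ γ ∧ γ < 1 ∧ 0 ≤ K ∧ ∀ x,
      ∫ y, |y| ^ ((p - 1) / 2) ∂(kernel π Ginv hπ hG h x) ≤ γ * |x| ^ ((p - 1) / 2) + K := by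
  have hGpos := hGloc.pos
  set s := (p - 1) / 2 with hs
  have hs0 : 0 ≤ s := by linarith
  have hs1 : s ≤ 1 := by linarith
  set J := ∫ u, limitDrift p v u with hJ
  have hev := (tendsto_integral_driftBound hG hv hw hp1 hp2 x₀).eventually_le_const
    (show J < J / 2 by linarith)
  have hev2 := (tendsto_norm_cobounded_atTop (E := ℝ)).eventually_ge_atTop x₀
  obtain ⟨r, -, hr⟩ := hasBasis_cobounded_norm.eventually_iff.1 (hev.and hev2)
  obtain ⟨a, b, -, hab⟩ := hGloc (Set.Icc (-|r|) |r|) isCompact_Icc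
  -- Half of the limiting drift `J` is given up to reach finite `x`; the maximum with `0` keeps the
  -- contraction factor nonnegative.
  refine ⟨max (1 + J / 2) 0, |r| ^ s + (2 + (|r| ^ 2 + h * |b|)), le_max_right _ _,
    max_lt (by linarith) one_pos, by positivity, fun x => ?_⟩
  have hVx : 0 ≤ |x| ^ s := by positivity
  rcases le_or_gt r |x| with hx | hx
  · obtain ⟨hx1, hx2⟩ := hr hx
    have h1 := integral_kernel_abs_rpow_le hπ hG hπpos hGpos hh hp1 hp2 hx₀ htail hx2
    have h2 : (1 + ∫ u, driftBound Ginv p x₀ h x u) * |x| ^ s ≤ max (1 + J / 2) 0 * |x| ^ s :=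
      mul_le_mul_of_nonneg_right ((add_le_add_right hx1 1).trans (le_max_left _ _)) hVx
    have h3 : 0 ≤ |r| ^ s + (2 + (|r| ^ 2 + h * |b|)) := by positivity
    linarith
  · have hxr : |x| ≤ |r| := hx.le.trans (le_abs_self r)
    have h1 := integral_kernel_le hπ hG hπpos hGpos hh (x := x) (f := fun y => |y| ^ s)
      (fun y => by positivity) (measurable_abs_rpow s) (integrable_abs_rpow_gaussianReal hs0 hs1 _ _)
    have h2 := integral_abs_rpow_gaussianReal_le hs0 hs1 x (propVar Ginv h x)
    rw [coe_propVar hGpos hh] at h2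
    have h3 : |x| ^ s ≤ |r| ^ s := Real.rpow_le_rpow (abs_nonneg x) hxr hs0
    have h4 : x ^ 2 ≤ |r| ^ 2 := by
      rw [← sq_abs x]; exact pow_le_pow_left₀ (abs_nonneg x) hxr 2
    have h5 : h * Ginv x ≤ h * |b| :=
      mul_le_mul_of_nonneg_left ((hab x (abs_le.1 hxr)).2.trans (le_abs_self b)) hh.le
    have h6 : 0 ≤ max (1 + J / 2) 0 * |x| ^ s := mul_nonneg (le_max_right _ _) hVx
    linarith

/-- The Lyapunov function is integrable under the target. -/
lemma integrable_abs_rpow_target (hπ : Measurable π) (hπpos : ∀ x, 0 < π x)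
    (hprob : IsProbabilityMeasure (target π)) {p x₀ : ℝ} (hp1 : 1 < p) (hx₀ : 0 < x₀)
    (htail : ∀ x u, x₀ ≤ |x| → 1 ≤ u → π (u * x) ≤ u ^ (-p) * π x) :
    Integrable (fun x => |x| ^ ((p - 1) / 2)) (target π) := by
  set s := (p - 1) / 2 with hs
  have hs0 : 0 ≤ s := by linarith
  have hπint : Integrable π := by
    refine ⟨hπ.aestronglyMeasurable, ?_⟩
    have h1 : target π Set.univ < ⊤ := measure_lt_top _ _
    rw [target, withDensity_apply _ MeasurableSet.univ, Measure.restrict_univ] at h1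
    simpa only [HasFiniteIntegral, Real.enorm_of_nonneg (hπpos _).le] using h1
  rw [target, integrable_withDensity_iff hπ.ennreal_ofReal
    (ae_of_all _ fun x => ENNReal.ofReal_lt_top)]
  simp only [ENNReal.toReal_ofReal (hπpos _).le]
  have hmeas : Measurable fun x => |x| ^ s * π x := (measurable_abs_rpow s).mul hπ
  have hpos : ∀ x, 0 ≤ |x| ^ s * π x := fun x => mul_nonneg (by positivity) (hπpos x).le
  -- The directions `e = 1` and `e = -1` treat both tails at once. The integrand is dominated by a
  -- multiple of `u^(s - p)`, and `s - p = -(p + 1) / 2 < -1`.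
  have hray : ∀ e : ℝ, |e| = 1 →
      IntegrableOn (fun u => |u * e| ^ s * π (u * e)) (Set.Ioi x₀) := by
    intro e he
    have he1 : x₀ ≤ |x₀ * e| := by rw [abs_mul, he, mul_one]; exact le_abs_self x₀
    refine Integrable.mono' ((integrableOn_Ioi_rpow_of_lt (a := s - p) (by linarith) hx₀).const_mul
        (x₀ ^ p * π (x₀ * e)))
      (hmeas.comp (measurable_id.mul_const e)).aestronglyMeasurable ?_
    filter_upwards [ae_restrict_mem measurableSet_Ioi] with u hu
    have hu1 : x₀ < u := hu
    have hu0 : 0 < u := hx₀.trans hu1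
    rw [Real.norm_of_nonneg (hpos _), abs_mul, he, mul_one, abs_of_pos hu0]
    have h1 := htail (x₀ * e) (u / x₀) he1 ((one_le_div hx₀).2 hu1.le)
    rw [← mul_assoc, div_mul_cancel₀ _ hx₀.ne', Real.div_rpow hu0.le hx₀.le,
      Real.rpow_neg hx₀.le, div_inv_eq_mul] at h1
    calc u ^ s * π (u * e) ≤ u ^ s * (u ^ (-p) * x₀ ^ p * π (x₀ * e)) := by gcongr
      _ = x₀ ^ p * π (x₀ * e) * (u ^ s * u ^ (-p)) := by ring
      _ = _ := by rw [← Real.rpow_add hu0, ← sub_eq_add_neg]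
  have hright : IntegrableOn (fun x => |x| ^ s * π x) (Set.Ioi x₀) := by
    simpa using hray 1 abs_one
  have hleft : IntegrableOn (fun x => |x| ^ s * π x) (Set.Iio (-x₀)) := by
    have h1 := hray (-1) (by simp)
    simp only [mul_neg_one] at h1
    have h2 := (Measure.measurePreserving_neg (volume : Measure ℝ)).integrableOn_comp_preimage
      (Homeomorph.neg ℝ).measurableEmbedding (f := fun x => |x| ^ s * π x) (s := Set.Iio (-x₀))
    refine h2.1 ?_
    have h3 : Neg.neg ⁻¹' Set.Iio (-x₀) = Set.Ioi x₀ := by ext x; simp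
    rw [h3]
    exact h1
  have hmid : IntegrableOn (fun x => |x| ^ s * π x) (Set.Icc (-x₀) x₀) := by
    refine Integrable.mono' (hπint.integrableOn.const_mul (x₀ ^ s)) hmeas.aestronglyMeasurable ?_
    filter_upwards [ae_restrict_mem measurableSet_Icc] with x hx
    rw [Real.norm_of_nonneg (hpos x)]
    exact mul_le_mul_of_nonneg_right
      (Real.rpow_le_rpow (abs_nonneg x) (abs_le.2 hx) hs0) (hπpos x).le
  rw [← integrableOn_univ]
  refine ((hleft.union hmid).union hright).mono_set fun x _ => ?_
  rcases lt_or_ge x (-x₀) with h1 | h1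
  · exact Or.inl (Or.inl h1)
  · rcases le_or_gt x x₀ with h2 | h2
    · exact Or.inl (Or.inr ⟨h1, h2⟩)
    · exact Or.inr h2

/-- A multiplicative form of the tail condition covering both signs of `x`. The exponent may be
lowered because `u ≥ 1`, which permits the reduction to `p ≤ 2`. -/
lemma PolyTails.exists_mul_le (hπpos : ∀ x, 0 < π x) {p q : ℝ} (hq : q ≤ p)
    (ht : PolyTails π p) :
    ∃ x₀ : ℝ, 0 < x₀ ∧ ∀ x u, x₀ ≤ |x| → 1 ≤ u → π (u * x) ≤ u ^ (-q) * π x := by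
  obtain ⟨x₀, hx₀, ht⟩ := ht
  refine ⟨x₀, hx₀, fun x u hx hu => ?_⟩
  have hu0 : 0 < u := one_pos.trans_le hu
  have hx0 : 0 < |x| := hx₀.trans_le hx
  have h1 := ht |x| (u * |x|) hx (le_mul_of_one_le_left hx0.le hu)
  have h2 : (u * |x|) ^ (-p) / |x| ^ (-p) = u ^ (-p) := by
    rw [Real.mul_rpow hu0.le hx0.le, mul_div_cancel_right₀ _ (by positivity)]
  rw [h2, div_le_iff₀ (hπpos _), div_le_iff₀ (hπpos _)] at h1
  have h3 : u ^ (-p) * π x ≤ u ^ (-q) * π x :=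
    mul_le_mul_of_nonneg_right (Real.rpow_le_rpow_of_exponent_le hu (by linarith)) (hπpos x).le
  refine le_trans ?_ h3
  rcases abs_cases x with ⟨he, -⟩ | ⟨he, -⟩
  · rw [he] at h1; exact h1.1
  · rw [he] at h1
    simpa using h1.2

end Drift

end PDRWM

theorem lemma3 (π Ginv : ℝ → ℝ) (hπ : Measurable π) (hG : Measurable Ginv)
    (hprob : MeasureTheory.IsProbabilityMeasure (PDRWM.target π))
    (hπloc : PDRWM.LocBoundedAway π) (hGloc : PDRWM.LocBoundedAway Ginv)
    (hquad : PDRWM.QuadraticGrowth Ginv)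
    (p : ℝ) (hp : 1 < p) (htail : PDRWM.PolyTails π p) :
    ∃ h₀ : ℝ, 0 < h₀ ∧ ∀ h : ℝ, 0 < h → h < h₀ →
      PDRWM.GeometricallyErgodic (PDRWM.kernel π Ginv hπ hG h) (PDRWM.target π) := by
  obtain ⟨C, hC0, hC⟩ := hquad
  -- Capping the exponent at `2` keeps `|u|^(q - 1)` below `1 + |u|`, as the limit problem requires.
  obtain ⟨q, hq1, hq2, hqp⟩ : ∃ q : ℝ, 1 < q ∧ q ≤ 2 ∧ q ≤ p :=
    ⟨min p 2, lt_min hp one_lt_two, min_le_right _ _, min_le_left _ _⟩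
  obtain ⟨x₀, hx₀, ht⟩ := htail.exists_mul_le hπloc.pos hqp
  obtain ⟨v₀, hv₀, hneg⟩ := PDRWM.exists_integral_limitDrift_neg hq1 hq2
  -- The limiting relative variance is `h * C`, which must stay below `v₀`.
  refine ⟨v₀ / C, by positivity, fun h hh hlt => ?_⟩
  have hv : 0 < h * C := by positivity
  obtain ⟨γ, K, hγ0, hγ1, hK, hdrift⟩ := PDRWM.exists_drift hπ hG hπloc.pos hGloc hh hv
    (PDRWM.tendsto_relVar hC h) hq1 hq2 hx₀ ht (hneg _ hv ((lt_div_iff₀ hC0).1 hlt))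
  have hs0 : 0 < (q - 1) / 2 := by linarith
  refine PDRWM.geometricallyErgodic_of_drift_of_minorization _ _
    (PDRWM.kernel_invariant hπ hG hπloc.pos hGloc.pos hh)
    (V := fun x => |x| ^ ((q - 1) / 2)) (fun x => by positivity)
    (fun x => PDRWM.integrable_kernel hπ hG hπloc.pos hGloc.pos hh (PDRWM.measurable_abs_rpow _)
      (PDRWM.integrable_abs_rpow_gaussianReal hs0.le (by linarith) _ _))
    hγ0 hγ1 hK hdrift (fun R => ?_)
    (PDRWM.integrable_abs_rpow_target hπ hπloc.pos hprob hq1 hx₀ ht)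
  obtain ⟨m, hm0, hm⟩ :=
    -- Sublevel sets of the Lyapunov function are bounded; `|R|` avoids a case split for negative
    -- `R`.
    PDRWM.exists_minorization hπ hG hπloc hGloc hh (|R| ^ ((q - 1) / 2)⁻¹)
  refine ⟨m, hm0, fun x hx => hm x ?_⟩
  rw [Real.le_rpow_inv_iff_of_pos (abs_nonneg x) (abs_nonneg R) hs0]
  exact hx.trans (le_abs_self R)
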